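/- **Proposition 1.1 (fusion principle).** Let $Y_1\subset Y_2\subset Y_3$ be compact smooth manifolds with boundary of the same dimension $n$, such that $Y_1\subset \mathring{Y}_2$ and $Y_2\subset\mathring{Y}_3$ ($Y_1$ and $Y_2$ being smoothly embedded in $Y_3$), and let $F$ be a flat complex vector bundle of rank $r$ on $Y_3$. Denote by $H^\cdot(Y_k,F)$ and $H^\cdot(Y_k,Y_j,F)$ $(j<k)$ the absolute and relative cohomologies with coefficients in $F$; they are finite-dimensional and vanish in degrees $>n$. For a finite-dimensional complex vector space $W$ put $\det W=\Lambda^{\dim W}W$, and for a finite-dimensional graded space $E^\cdot$ put $\det E^\cdot=\bigotimes_i(\det E^i)^{(-1)^i}$, where the inverse of a line is its dual. For a triple $P\subset Q\subset R$ taken among $\varnothing,Y_1,Y_2,Y_3$, the long exact sequence $$\cdots\to H^i(R,Q,F)\to H^i(R,P,F)\to H^i(Q,P,F)\to H^{i+1}(R,Q,F)\to\cdots$$ is an acyclic complex of finite-dimensional vector spaces. An acyclic complex $(C^\cdot,d)$ has a canonical generator of its determinant line, namely $\bigotimes_k\big(\bigwedge_j ds^{k-1}_j\wedge\bigwedge_j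 s^k_j\big)^{(-1)^k}$, where $(s^k_j)_j$ in $C^k$ projects to a basis of $C^k/dC^{k-1}$. The generator of the long exact sequence defines an isomorphism of lines $$\det H^\cdot(Q,P,F)\otimes\det H^\cdot(R,Q,F)\simeq\det H^\cdot(R,P,F).$$ Write $f_{1,21}$, $f_{2,32}$, $f_{1,31}$, $f_{21,32}$ for these isomorphisms for the triples $(\varnothing,Y_1,Y_2)$, $(\varnothing,Y_2,Y_3)$, $(\varnothing,Y_1,Y_3)$, $(Y_1,Y_2,Y_3)$ respectively. Then there is $\mu\in\mathbf C$ with $|\mu|=1$ such that $$f_{2,32}\circ(f_{1,21}\otimes\mathrm{id})=\mu\, f_{1,31}\circ(\mathrm{id}\otimes f_{21,32})$$ as isomorphisms $\det H^\cdot(Y_1,F)\otimes\det H^\cdot(Y_2,Y_1,F)\otimes\det H^\cdot(Y_3,Y_2,F)\simeq\det H^\cdot(Y_3,F)$. -/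

import Mathlib

open CategoryTheory Filter Topology Set
open scoped Manifold ContDiff TensorProduct

/-- A flat complex vector bundle of rank `r` on `X`: a complex vector bundle (given by an open
cover, indexed by `ι`, and a cocycle of transition functions with values in `GL_r(ℂ)`) whose
transition functions are locally constant. The fibre at `x` is `F.Fiber x`. -/
structure FlatVectorBundle (X : Type*) [TopologicalSpace X] (r : ℕ) (ι : Type*)
    extends VectorBundleCore ℂ X (Fin r → ℂ) ι where
  flat : ∀ i j, ∀ x ∈ baseSet i ∩ baseSet j, ∀ᶠ y in 𝓝 x, coordChange i j y = coordChange i j x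

namespace FlatVectorBundle

/-- The fibre of a flat vector bundle at a point. -/
abbrev Fiber {X : Type*} [TopologicalSpace X] {r : ℕ} {ι : Type*} (F : FlatVectorBundle X r ι)
    (x : X) : Type :=
  F.toVectorBundleCore.Fiber x

section Sections

variable {X S T : Type*} [TopologicalSpace X] [TopologicalSpace S] [TopologicalSpace T]
  {r : ℕ} {ι : Type*} (F : FlatVectorBundle X r ι)

/-- The coordinates of a vector of the fibre `F_x` in the `i`-th local frame. -/
noncomputable def coord (i : ι) (x : X) : F.Fiber x →ₗ[ℂ] (Fin r → ℂ) where
  toFun v := F.coordChange (F.indexAt x) i x v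
  map_add' v w := (F.coordChange (F.indexAt x) i x).map_add v w
  map_smul' c v := (F.coordChange (F.indexAt x) i x).map_smul c v

theorem coord_injective (i : ι) (x : X) (hx : x ∈ F.baseSet i) :
    Function.Injective (F.coord i x) := by
  intro v w h
  have hm := F.mem_baseSet_at x
  have h5 : F.coordChange i (F.indexAt x) x (F.coordChange (F.indexAt x) i x v) =
      F.coordChange i (F.indexAt x) x (F.coordChange (F.indexAt x) i x w) :=
    congrArg (F.coordChange i (F.indexAt x) x) h
  have e : ∀ u, F.coordChange i (F.indexAt x) x (F.coordChange (F.indexAt x) i x u) = u := fun u =>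
    (F.coordChange_comp _ _ _ _ ⟨⟨hm, hx⟩, hm⟩ u).trans (F.coordChange_self _ _ hm u)
  exact (e v).symm.trans (h5.trans (e w))

/-- The space of flat (that is, locally constant) sections of the pull-back `g^* F` of a flat
vector bundle by a continuous map `g : T → X`: in every local flat frame, the coordinates of the
section are locally constant. -/
noncomputable def flatSections (g : C(T, X)) : Submodule ℂ (∀ t, F.Fiber (g t)) where
  carrier := {s | ∀ (i : ι) (t : T), g t ∈ F.baseSet i →
    ∀ᶠ t' in 𝓝 t, F.coord i (g t') (s t') = F.coord i (g t) (s t)}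
  add_mem' := by
    intro a b ha hb i t ht
    filter_upwards [ha i t ht, hb i t ht] with t' h1 h2
    rw [Pi.add_apply, Pi.add_apply, map_add, map_add, h1, h2]
  zero_mem' := by
    intro i t ht
    refine Eventually.of_forall fun t' => ?_
    rw [Pi.zero_apply, Pi.zero_apply, map_zero, map_zero]
  smul_mem' := by
    intro c a ha i t ht
    filter_upwards [ha i t ht] with t' h1
    rw [Pi.smul_apply, Pi.smul_apply, map_smul, map_smul, h1]

/-- Pull-back of flat sections along a continuous map `h : S → T`. -/
noncomputable def pullback (g : C(T, X)) (h : C(S, T)) : F.flatSections g →ₗ[ℂ] F.flatSections (g.comp h) where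
  toFun s := ⟨fun t => s.1 (h t), fun i t ht =>
    (h.continuous.tendsto t).eventually (s.2 i (h t) ht)⟩
  map_add' _ _ := rfl
  map_smul' _ _ := rfl

/-- The fibre bundle with fibre `ℂ^r`, equipped with the discrete topology, that underlies a flat
vector bundle. Its projection is a covering map. -/
noncomputable def discreteCore : letI : TopologicalSpace (Fin r → ℂ) := ⊥; FiberBundleCore ι X (Fin r → ℂ) :=
  letI : TopologicalSpace (Fin r → ℂ) := ⊥
  { baseSet := F.baseSet
    isOpen_baseSet := F.isOpen_baseSet
    indexAt := F.indexAt
    mem_baseSet_at := F.mem_baseSet_at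
    coordChange := fun i j x v => F.coordChange i j x v
    coordChange_self := F.coordChange_self
    coordChange_comp := F.coordChange_comp
    continuousOn_coordChange := by
      intro i j p hp
      have : DiscreteTopology (Fin r → ℂ) := ⟨rfl⟩
      refine ContinuousAt.continuousWithinAt ?_
      have h1 : ∀ᶠ q : X × (Fin r → ℂ) in 𝓝 p, F.coordChange i j q.1 = F.coordChange i j p.1 :=
        (continuous_fst.tendsto p).eventually (F.flat i j p.1 hp.1)
      have h2 : ∀ᶠ q : X × (Fin r → ℂ) in 𝓝 p, q.2 = p.2 :=
        (continuous_snd.tendsto p).eventually (show ∀ᶠ w in 𝓝 p.2, w = p.2 by rw [nhds_discrete]; exact rfl)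
      refine (continuousAt_const (y := F.coordChange i j p.1 p.2)).congr ?_
      filter_upwards [h1, h2] with q hq1 hq2
      rw [hq1, hq2] }

theorem flatSections_ext [PreconnectedSpace T] (g : C(T, X)) (t₀ : T)
    (s s' : F.flatSections g) (h : s.1 t₀ = s'.1 t₀) : s = s' := by
  have key : IsClopen {t : T | s.1 t = s'.1 t} := by
    have hloc : ∀ t : T, ∀ᶠ t' in 𝓝 t, (s.1 t' = s'.1 t' ↔ s.1 t = s'.1 t) := by
      intro t
      have hm := F.mem_baseSet_at (g t)
      have hb : ∀ᶠ t' in 𝓝 t, g t' ∈ F.baseSet (F.indexAt (g t)) :=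
        (g.continuous.tendsto t).eventually ((F.isOpen_baseSet _).mem_nhds hm)
      filter_upwards [s.2 _ t hm, s'.2 _ t hm, hb] with t' h1 h2 h3
      constructor
      · intro he
        rw [he] at h1
        exact F.coord_injective _ _ hm (h1.symm.trans h2)
      · intro he
        rw [he] at h1
        exact F.coord_injective _ _ h3 (h1.trans h2.symm)
    constructor
    · rw [← isOpen_compl_iff, isOpen_iff_mem_nhds]
      intro t ht
      filter_upwards [hloc t] with t' h1 h2
      exact ht (h1.1 h2)
    · rw [isOpen_iff_mem_nhds]
      intro t ht
      filter_upwards [hloc t] with t' h1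
      exact h1.2 ht
  have huniv := key.eq_univ ⟨t₀, h⟩
  apply Subtype.ext
  funext t
  exact (huniv ▸ mem_univ t : t ∈ {t : T | s.1 t = s'.1 t})

theorem exists_flatSection [SimplyConnectedSpace T] [LocallyPathConnectedSpace T]
    (g : C(T, X)) (t₀ : T) (v : F.Fiber (g t₀)) : ∃ s : F.flatSections g, s.1 t₀ = v := by
  let _ : TopologicalSpace (Fin r → ℂ) := ⊥
  have : DiscreteTopology (Fin r → ℂ) := ⟨rfl⟩
  have hcov : IsCoveringMap (Bundle.TotalSpace.proj : (F.discreteCore).TotalSpace → X) :=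
    FiberBundle.isCoveringMap (F := Fin r → ℂ) (E := F.discreteCore.Fiber)
  obtain ⟨Γ, ⟨hΓ0, hΓ⟩, -⟩ := hcov.existsUnique_continuousMap_lifts g t₀ ⟨g t₀, v⟩ rfl
  have hp : ∀ t, (Γ t).1 = g t := fun t => congrFun hΓ t
  have hs : ∃ s : ∀ t, F.Fiber (g t), ∀ t, Γ t = ⟨g t, s t⟩ := by
    have : ∀ t, ∃ w : F.Fiber (g t), Γ t = ⟨g t, w⟩ := by
      intro t
      have h := hp t
      generalize Γ t = e at h
      obtain ⟨x, w⟩ := e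
      subst h
      exact ⟨w, rfl⟩
    choose s hs using this
    exact ⟨s, hs⟩
  obtain ⟨s, hs⟩ := hs
  refine ⟨⟨s, ?_⟩, ?_⟩
  · intro i t ht
    have hsrc : Γ t ∈ (F.discreteCore.localTriv i).source := by
      rw [F.discreteCore.mem_localTriv_source, hs t]
      exact ht
    have hc : ContinuousAt (fun t' => (F.discreteCore.localTriv i (Γ t')).2) t :=
      (continuous_snd.continuousAt).comp
        (((F.discreteCore.localTriv i).continuousAt hsrc).comp Γ.continuous.continuousAt)
    have := hc.tendsto.eventually (show ∀ᶠ w in 𝓝 _, w = _ by rw [nhds_discrete]; exact rfl)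
    filter_upwards [this] with t' h
    rw [hs t', hs t] at h
    exact h
  · have h1 := hs t₀
    rw [hΓ0] at h1
    have h2 : HEq v (s t₀) := (Bundle.TotalSpace.mk.inj h1).2
    exact (eq_of_heq h2).symm

theorem pullback_bijective [SimplyConnectedSpace T] [LocallyPathConnectedSpace T]
    [SimplyConnectedSpace S] (g : C(T, X)) (h : C(S, T)) :
    Function.Bijective (F.pullback g h) := by
  obtain ⟨s₀⟩ : Nonempty S := inferInstance
  constructor
  · intro a b hab
    exact F.flatSections_ext g (h s₀) a b (congrFun (congrArg Subtype.val hab) s₀)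
  · intro a
    obtain ⟨b, hb⟩ := F.exists_flatSection g (h s₀) (a.1 s₀)
    exact ⟨b, F.flatSections_ext (g.comp h) s₀ _ _ hb⟩

/-- On simply connected spaces, a flat section of `(g ∘ h)^* F` is the pull-back of a unique flat
section of `g^* F`; `F.extend g h` maps the former to the latter (parallel transport). -/
noncomputable def extend [SimplyConnectedSpace T] [LocallyPathConnectedSpace T]
    [SimplyConnectedSpace S] (g : C(T, X)) (h : C(S, T)) :
    F.flatSections (g.comp h) ≃ₗ[ℂ] F.flatSections g :=
  (LinearEquiv.ofBijective (F.pullback g h) (F.pullback_bijective g h)).symm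

theorem extend_eq_iff [SimplyConnectedSpace T] [LocallyPathConnectedSpace T]
    [SimplyConnectedSpace S] (g : C(T, X)) (h : C(S, T)) (a : F.flatSections (g.comp h))
    (b : F.flatSections g) : F.extend g h a = b ↔ a = F.pullback g h b := by
  unfold extend
  rw [LinearEquiv.symm_apply_eq]
  rfl

end Sections


section Cohomology

/-- The standard topological simplex of dimension `k`. -/
abbrev TopSimplex (k : SimplexCategory) : Type := stdSimplex ℝ (Fin (k.len + 1))

instance (k : SimplexCategory) : SimplyConnectedSpace (TopSimplex k) :=
  have : ContractibleSpace (TopSimplex k) :=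
    (convex_stdSimplex ℝ (Fin (k.len + 1))).contractibleSpace ⟨_, single_mem_stdSimplex ℝ (0 : Fin (k.len + 1))⟩
  inferInstance

instance (k : SimplexCategory) : LocallyPathConnectedSpace (TopSimplex k) :=
  (convex_stdSimplex ℝ (Fin (k.len + 1))).locallyPathConnectedSpace

/-- The affine map of standard simplices induced by a monotone map of vertices. -/
noncomputable def simplexMap {k l : SimplexCategory} (φ : k ⟶ l) : C(TopSimplex k, TopSimplex l) :=
  ⟨stdSimplex.map φ, stdSimplex.continuous_map φ⟩

theorem simplexMap_id (k : SimplexCategory) : simplexMap (𝟙 k) = ContinuousMap.id _ := by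
  ext1 x
  exact stdSimplex.map_id_apply x

theorem simplexMap_comp {k l m : SimplexCategory} (φ : k ⟶ l) (ψ : l ⟶ m) :
    simplexMap (φ ≫ ψ) = (simplexMap ψ).comp (simplexMap φ) := by
  ext1 x
  exact (stdSimplex.map_comp_apply φ ψ x).symm

universe u

variable {X : Type u} [TopologicalSpace X]

/-- The singular simplices of the subspace `Q` of `X`. -/
abbrev SingularSimplex (Q : Set X) (k : SimplexCategory) : Type u :=
  {σ : C(TopSimplex k, X) // ∀ t, σ t ∈ Q}

/-- The face (or degeneracy) of a singular simplex given by a monotone map of vertices. -/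
noncomputable def SingularSimplex.face {Q : Set X} {k l : SimplexCategory} (σ : SingularSimplex Q l)
    (φ : k ⟶ l) : SingularSimplex Q k :=
  ⟨σ.1.comp (simplexMap φ), fun t => σ.2 (simplexMap φ t)⟩

variable {r : ℕ} {ι : Type*} (F : FlatVectorBundle X r ι)

/-- Singular `k`-cochains of the pair `(Q, P)` of subspaces of `X` with coefficients in the flat
vector bundle `F`: such a cochain assigns to each singular simplex `σ : Δ^k → Q` a flat section of
`σ^* F` (equivalently, an element of the fibre of `F` at a vertex of `σ`), and zero to the
simplices that lie in `P`. -/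
noncomputable def cochains (Q P : Set X) (k : SimplexCategory) :
    Submodule ℂ (∀ σ : SingularSimplex Q k, F.flatSections σ.1) where
  carrier := {c | ∀ σ : SingularSimplex Q k, (∀ t, σ.1 t ∈ P) → c σ = 0}
  add_mem' := by
    intro a b ha hb σ hσ
    rw [Pi.add_apply, ha σ hσ, hb σ hσ, add_zero]
  zero_mem' := fun _ _ => rfl
  smul_mem' := by
    intro c a ha σ hσ
    rw [Pi.smul_apply, ha σ hσ, smul_zero]

/-- The extension of a flat section on a face of a singular simplex to the whole simplex. -/
noncomputable def extendFace {Q : Set X} {k l : SimplexCategory} (σ : SingularSimplex Q l)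
    (φ : k ⟶ l) : F.flatSections (σ.face φ).1 ≃ₗ[ℂ] F.flatSections σ.1 :=
  F.extend σ.1 (simplexMap φ)

/-- The map on cochains induced by a monotone map of vertices: the value on `σ` of the image of `c`
is the flat section that extends the value of `c` on the corresponding face of `σ`. -/
noncomputable def cochainsMap (Q P : Set X) {k l : SimplexCategory} (φ : k ⟶ l) :
    F.cochains Q P k →ₗ[ℂ] F.cochains Q P l where
  toFun c := ⟨fun σ => F.extendFace σ φ (c.1 (σ.face φ)), fun σ hσ =>
    (congrArg (F.extendFace σ φ) (c.2 (σ.face φ) (fun t => hσ (simplexMap φ t)))).trans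
      (map_zero (F.extendFace σ φ))⟩
  map_add' a b := by
    apply Subtype.ext
    funext σ
    exact map_add (F.extendFace σ φ) _ _
  map_smul' c a := by
    apply Subtype.ext
    funext σ
    exact map_smul (F.extendFace σ φ) _ _

theorem cochainsMap_apply_val {Q P : Set X} {k l : SimplexCategory} (φ : k ⟶ l)
    (c : F.cochains Q P k) (σ : SingularSimplex Q l) (t : TopSimplex k) :
    ((F.cochainsMap Q P φ c).1 σ).1 (simplexMap φ t) = (c.1 (σ.face φ)).1 t := by
  have h := (F.extend_eq_iff σ.1 (simplexMap φ) (c.1 (σ.face φ))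
    ((F.cochainsMap Q P φ c).1 σ)).1 rfl
  exact (congrFun (congrArg Subtype.val h) t).symm

theorem cochains_val_heq {Q P : Set X} {k : SimplexCategory} (c : F.cochains Q P k)
    {σ τ : SingularSimplex Q k} (h : σ = τ) {t t' : TopSimplex k} (ht : t = t') :
    (c.1 σ).1 t ≍ (c.1 τ).1 t' := by
  subst h
  subst ht
  rfl

theorem cochainsMap_id (Q P : Set X) (k : SimplexCategory) (c : F.cochains Q P k) :
    F.cochainsMap Q P (𝟙 k) c = c := by
  apply Subtype.ext
  funext σ
  obtain ⟨t⟩ : Nonempty (TopSimplex k) := inferInstance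
  refine F.flatSections_ext _ t _ _ (eq_of_heq ?_)
  have ht : simplexMap (𝟙 k) t = t := by rw [simplexMap_id]; rfl
  refine (F.cochains_val_heq _ rfl ht.symm).trans ?_
  refine (heq_of_eq (F.cochainsMap_apply_val (𝟙 k) c σ t)).trans ?_
  refine F.cochains_val_heq c (Subtype.ext ?_) rfl
  change σ.1.comp (simplexMap (𝟙 k)) = σ.1
  rw [simplexMap_id, ContinuousMap.comp_id]

theorem cochainsMap_comp (Q P : Set X) {k l m : SimplexCategory} (φ : k ⟶ l) (ψ : l ⟶ m)
    (c : F.cochains Q P k) :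
    F.cochainsMap Q P (φ ≫ ψ) c = F.cochainsMap Q P ψ (F.cochainsMap Q P φ c) := by
  apply Subtype.ext
  funext σ
  obtain ⟨t⟩ : Nonempty (TopSimplex k) := inferInstance
  refine F.flatSections_ext _ (simplexMap (φ ≫ ψ) t) _ _ (eq_of_heq ?_)
  have ht : simplexMap (φ ≫ ψ) t = simplexMap ψ (simplexMap φ t) := by rw [simplexMap_comp]; rfl
  have e1 := F.cochainsMap_apply_val (φ ≫ ψ) c σ t
  have e2 := F.cochainsMap_apply_val ψ (F.cochainsMap Q P φ c) σ (simplexMap φ t)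
  have e3 := F.cochainsMap_apply_val φ c (σ.face ψ) t
  refine (heq_of_eq e1).trans ?_
  refine HEq.trans ?_ (F.cochains_val_heq (F.cochainsMap Q P ψ (F.cochainsMap Q P φ c))
    (rfl : σ = σ) ht.symm)
  refine HEq.trans ?_ (heq_of_eq (e2.trans e3).symm)
  refine F.cochains_val_heq c (Subtype.ext ?_) rfl
  change σ.1.comp (simplexMap (φ ≫ ψ)) = (σ.1.comp (simplexMap ψ)).comp (simplexMap φ)
  rw [simplexMap_comp, ContinuousMap.comp_assoc]

/-- The cosimplicial vector space of singular cochains of a pair with coefficients in `F`. -/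
noncomputable def cosimplicialCochains (Q P : Set X) : CosimplicialObject (ModuleCat.{u} ℂ) where
  obj k := ModuleCat.of ℂ (F.cochains Q P k)
  map φ := ModuleCat.ofHom (F.cochainsMap Q P φ)
  map_id k := ModuleCat.hom_ext (LinearMap.ext fun c => F.cochainsMap_id Q P k c)
  map_comp φ ψ := ModuleCat.hom_ext (LinearMap.ext fun c => F.cochainsMap_comp Q P φ ψ c)

/-- The singular cochain complex of the pair `(Q, P)` with coefficients in `F`, with the
differential `(dc)(σ) = ∑ (-1)^i c(σ ∘ δ_i)`. -/
noncomputable def cochainComplex (Q P : Set X) : CochainComplex (ModuleCat.{u} ℂ) ℕ :=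
  (AlgebraicTopology.alternatingCofaceMapComplex (ModuleCat.{u} ℂ)).obj (F.cosimplicialCochains Q P)

/-- The inclusion of the cochains of `(R, Q)` in those of `(R, P)`, for `P ⊆ Q`. -/
noncomputable def cochainsIncl (R : Set X) {P Q : Set X} (h : P ⊆ Q) (k : SimplexCategory) :
    F.cochains R Q k →ₗ[ℂ] F.cochains R P k where
  toFun c := ⟨c.1, fun σ hσ => c.2 σ fun t => h (hσ t)⟩
  map_add' _ _ := rfl
  map_smul' _ _ := rfl

/-- The restriction of the cochains of `(R, P)` to `(Q, P)`, for `Q ⊆ R`. -/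
noncomputable def cochainsRestr {Q R : Set X} (h : Q ⊆ R) (P : Set X) (k : SimplexCategory) :
    F.cochains R P k →ₗ[ℂ] F.cochains Q P k where
  toFun c := ⟨fun σ => c.1 ⟨σ.1, fun t => h (σ.2 t)⟩, fun _ hσ => c.2 _ hσ⟩
  map_add' _ _ := rfl
  map_smul' _ _ := rfl

/-- The inclusion of the cochain complex of `(R, Q)` in that of `(R, P)`, for `P ⊆ Q`. -/
noncomputable def complexIncl (R : Set X) {P Q : Set X} (h : P ⊆ Q) :
    F.cochainComplex R Q ⟶ F.cochainComplex R P :=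
  (AlgebraicTopology.alternatingCofaceMapComplex (ModuleCat.{u} ℂ)).map
    { app := fun k => ModuleCat.ofHom (F.cochainsIncl R h k)
      naturality := fun _ _ _ => rfl }

/-- The restriction of the cochain complex of `(R, P)` to that of `(Q, P)`, for `Q ⊆ R`. -/
noncomputable def complexRestr {Q R : Set X} (h : Q ⊆ R) (P : Set X) :
    F.cochainComplex R P ⟶ F.cochainComplex Q P :=
  (AlgebraicTopology.alternatingCofaceMapComplex (ModuleCat.{u} ℂ)).map
    { app := fun k => ModuleCat.ofHom (F.cochainsRestr h P k)
      naturality := fun _ _ _ => rfl }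

/-- The short exact sequence of cochain complexes of a triple `P ⊆ Q ⊆ R`,
`0 → C(R, Q; F) → C(R, P; F) → C(Q, P; F) → 0`. -/
noncomputable def tripleSequence {P Q R : Set X} (hPQ : P ⊆ Q) (hQR : Q ⊆ R) :
    ShortComplex (CochainComplex (ModuleCat.{u} ℂ) ℕ) where
  X₁ := F.cochainComplex R Q
  X₂ := F.cochainComplex R P
  X₃ := F.cochainComplex Q P
  f := F.complexIncl R hPQ
  g := F.complexRestr hQR P
  zero := by
    ext k : 2
    refine LinearMap.ext fun c => Subtype.ext (funext fun σ => ?_)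
    exact c.2 ⟨σ.1, fun t => hQR (σ.2 t)⟩ σ.2

theorem tripleSequence_shortExact {P Q R : Set X} (hPQ : P ⊆ Q) (hQR : Q ⊆ R) :
    (F.tripleSequence hPQ hQR).ShortExact := by
  classical
  rw [HomologicalComplex.shortExact_iff_degreewise_shortExact]
  intro k
  have hinj : Function.Injective (F.cochainsIncl R hPQ (SimplexCategory.mk k)) := by
    intro a b h
    have h' := congrArg Subtype.val h
    exact Subtype.ext h'
  have hsurj : Function.Surjective (F.cochainsRestr hQR P (SimplexCategory.mk k)) := by
    intro c
    refine ⟨⟨fun σ => if h : ∀ t, σ.1 t ∈ Q then c.1 ⟨σ.1, h⟩ else 0, ?_⟩, ?_⟩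
    · intro σ hσ
      have h : ∀ t, σ.1 t ∈ Q := fun t => hPQ (hσ t)
      simp only [h, implies_true, dite_true]
      exact c.2 ⟨σ.1, h⟩ hσ
    · apply Subtype.ext
      funext σ
      exact dif_pos σ.2
  have hexact : Function.Exact (F.cochainsIncl R hPQ (SimplexCategory.mk k))
      (F.cochainsRestr hQR P (SimplexCategory.mk k)) := by
    intro c
    constructor
    · intro h
      refine ⟨⟨c.1, fun σ hσ => ?_⟩, rfl⟩
      exact congrFun (congrArg Subtype.val h) ⟨σ.1, hσ⟩
    · rintro ⟨a, rfl⟩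
      apply Subtype.ext
      funext σ
      exact a.2 ⟨σ.1, fun t => hQR (σ.2 t)⟩ σ.2
  exact ModuleCat.shortComplex_shortExact _ hexact hinj hsurj

/-- The cohomology `H^i(Q, P; F)` of the pair `(Q, P)` of subspaces of `X`, with coefficients in
`F`. The absolute cohomology `H^i(Q; F)` is the case `P = ∅`. -/
noncomputable abbrev cohomology (Q P : Set X) (i : ℕ) : ModuleCat.{u} ℂ :=
  (F.cochainComplex Q P).homology i

end Cohomology

end FlatVectorBundle

section Determinant

universe u

/-- The determinant line `det W = Λ^{dim W} W` (for `s = false`), respectively its inverse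
`(det W)⁻¹ = (det W)^*` (for `s = true`), of a finite-dimensional complex vector space `W`. -/
def DetLine (W : Type u) [AddCommGroup W] [Module ℂ W] : Bool → Type u
  | false => ⋀[ℂ]^(Module.finrank ℂ W) W
  | true => Module.Dual ℂ (⋀[ℂ]^(Module.finrank ℂ W) W)

noncomputable instance (W : Type u) [AddCommGroup W] [Module ℂ W] (s : Bool) :
    AddCommGroup (DetLine W s) :=
  match s with
  | false => inferInstanceAs (AddCommGroup (⋀[ℂ]^(Module.finrank ℂ W) W))
  | true => inferInstanceAs (AddCommGroup (Module.Dual ℂ (⋀[ℂ]^(Module.finrank ℂ W) W)))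

noncomputable instance (W : Type u) [AddCommGroup W] [Module ℂ W] (s : Bool) :
    Module ℂ (DetLine W s) :=
  match s with
  | false => inferInstanceAs (Module ℂ (⋀[ℂ]^(Module.finrank ℂ W) W))
  | true => inferInstanceAs (Module ℂ (Module.Dual ℂ (⋀[ℂ]^(Module.finrank ℂ W) W)))

section Volume

variable {W : Type u} [AddCommGroup W] [Module ℂ W] {m : ℕ}

/-- A basis of `W` with `m` elements, as a basis indexed by `Fin (dim W)`. -/
noncomputable def basisFinrank (b : Module.Basis (Fin m) ℂ W) :
    Module.Basis (Fin (Module.finrank ℂ W)) ℂ W :=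
  b.reindex (finCongr ((Module.finrank_eq_card_basis b).trans (Fintype.card_fin m)).symm)

/-- The element `b_1 ∧ ⋯ ∧ b_m` of `det W`. -/
noncomputable def wedge (b : Module.Basis (Fin m) ℂ W) : ⋀[ℂ]^(Module.finrank ℂ W) W :=
  exteriorPower.ιMulti ℂ (Module.finrank ℂ W) (basisFinrank b)

/-- The element `(b_1 ∧ ⋯ ∧ b_m)⁻¹` of `(det W)^*`: the linear form on `det W` given by the
determinant in the basis `b`, which takes the value `1` on `b_1 ∧ ⋯ ∧ b_m`. -/
noncomputable def wedgeInv (b : Module.Basis (Fin m) ℂ W) :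
    Module.Dual ℂ (⋀[ℂ]^(Module.finrank ℂ W) W) :=
  exteriorPower.alternatingMapLinearEquiv (basisFinrank b).det

theorem wedgeInv_wedge (b : Module.Basis (Fin m) ℂ W) : wedgeInv b (wedge b) = 1 := by
  rw [wedgeInv, wedge, exteriorPower.alternatingMapLinearEquiv_apply_ιMulti]
  exact (basisFinrank b).det_self

theorem wedgeInv_smul_wedge (b : Module.Basis (Fin m) ℂ W)
    (x : ⋀[ℂ]^(Module.finrank ℂ W) W) : wedgeInv b x • wedge b = x := by
  have h : (wedgeInv b).smulRight (wedge b) = LinearMap.id := by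
    apply exteriorPower.linearMap_ext
    refine Module.Basis.ext_alternating (basisFinrank b) fun v hv => ?_
    let σ : Equiv.Perm (Fin (Module.finrank ℂ W)) :=
      Equiv.ofBijective v (Finite.injective_iff_bijective.1 hv)
    have h1 := (((wedgeInv b).smulRight (wedge b)).compAlternatingMap
      (exteriorPower.ιMulti ℂ (Module.finrank ℂ W))).map_perm (basisFinrank b) σ
    have h2 := (LinearMap.id.compAlternatingMap
      (exteriorPower.ιMulti ℂ (Module.finrank ℂ W) (M := W))).map_perm (basisFinrank b) σ
    refine h1.trans (Eq.trans ?_ h2.symm)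
    congr 1
    change wedgeInv b (wedge b) • wedge b = wedge b
    rw [wedgeInv_wedge, one_smul]
  exact LinearMap.congr_fun h x

/-- The generator of `DetLine W s` defined by a basis `b` of `W`: `b_1 ∧ ⋯ ∧ b_m` or its inverse. -/
noncomputable def vol (b : Module.Basis (Fin m) ℂ W) : (s : Bool) → DetLine W s
  | false => wedge b
  | true => wedgeInv b

/-- The coordinate with respect to the generator `vol b s` of the line `DetLine W s`. -/
noncomputable def volCoord (b : Module.Basis (Fin m) ℂ W) : (s : Bool) → DetLine W s →ₗ[ℂ] ℂ
  | false => wedgeInv b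
  | true => Module.Dual.eval ℂ (⋀[ℂ]^(Module.finrank ℂ W) W) (wedge b)

theorem volCoord_vol (b : Module.Basis (Fin m) ℂ W) (s : Bool) : volCoord b s (vol b s) = 1 := by
  cases s
  · exact wedgeInv_wedge b
  · exact wedgeInv_wedge b

theorem volCoord_smul_vol (b : Module.Basis (Fin m) ℂ W) (s : Bool) (x : DetLine W s) :
    volCoord b s x • vol b s = x := by
  cases s
  · exact wedgeInv_smul_wedge b x
  · refine LinearMap.ext fun y => ?_
    change Module.Dual ℂ (⋀[ℂ]^(Module.finrank ℂ W) W) at x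
    have h := congrArg x (wedgeInv_smul_wedge b y)
    rw [map_smul, smul_eq_mul, mul_comm] at h
    exact h

end Volume

/-- The determinant line `det E = ⨂_{i = 0}^n (det E^i)^{(-1)^i}` of a graded vector space `E`
that is concentrated in the degrees `0, …, n`. -/
abbrev GradedDet (n : ℕ) (E : ℕ → ModuleCat.{u} ℂ) : Type u :=
  ⨂[ℂ] i : Fin (n + 1), DetLine (E i) (i : ℕ).bodd

section GradedVolume

variable {E : ℕ → ModuleCat.{u} ℂ} {m : ℕ → ℕ} (n : ℕ)

/-- The generator of `det E` defined by a basis of `E^i` for each `i`. -/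
noncomputable def gradedVol (b : ∀ i, Module.Basis (Fin (m i)) ℂ (E i)) : GradedDet n E :=
  PiTensorProduct.tprod ℂ fun i : Fin (n + 1) => vol (b i) (i : ℕ).bodd

/-- The coordinate with respect to the generator `gradedVol n b` of the line `det E`. -/
noncomputable def gradedVolCoord (b : ∀ i, Module.Basis (Fin (m i)) ℂ (E i)) :
    GradedDet n E →ₗ[ℂ] ℂ :=
  PiTensorProduct.lift ((MultilinearMap.mkPiAlgebra ℂ (Fin (n + 1)) ℂ).compLinearMap
    fun i => volCoord (b i) (i : ℕ).bodd)

theorem gradedVolCoord_gradedVol (b : ∀ i, Module.Basis (Fin (m i)) ℂ (E i)) :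
    gradedVolCoord n b (gradedVol n b) = 1 := by
  rw [gradedVolCoord, gradedVol, PiTensorProduct.lift.tprod]
  simp [volCoord_vol]

theorem gradedVolCoord_smul_gradedVol (b : ∀ i, Module.Basis (Fin (m i)) ℂ (E i))
    (x : GradedDet n E) : gradedVolCoord n b x • gradedVol n b = x := by
  have h : (gradedVolCoord n b).smulRight (gradedVol n b) = LinearMap.id := by
    apply PiTensorProduct.ext
    ext v
    have e : v = fun i : Fin (n + 1) => volCoord (b i) (i : ℕ).bodd (v i) • vol (b i) (i : ℕ).bodd :=
      funext fun i => (volCoord_smul_vol (b i) _ (v i)).symm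
    conv_rhs => rw [e]
    simp only [LinearMap.compMultilinearMap_apply, LinearMap.id_apply, LinearMap.smulRight_apply]
    rw [MultilinearMap.map_smul_univ, gradedVolCoord, PiTensorProduct.lift.tprod, gradedVol]
    simp
  exact LinearMap.congr_fun h x

end GradedVolume

/-- A long exact sequence
`0 → A^0 → B^0 → C^0 → A^1 → B^1 → C^1 → A^2 → ⋯` of complex vector spaces. -/
structure LongExactSequence where
  A : ℕ → ModuleCat.{u} ℂ
  B : ℕ → ModuleCat.{u} ℂ
  C : ℕ → ModuleCat.{u} ℂ
  a : ∀ i, A i →ₗ[ℂ] B i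
  b : ∀ i, B i →ₗ[ℂ] C i
  δ : ∀ i, C i →ₗ[ℂ] A (i + 1)
  injective_a : Function.Injective (a 0)
  exact_a_b : ∀ i, Function.Exact (a i) (b i)
  exact_b_δ : ∀ i, Function.Exact (b i) (δ i)
  exact_δ_a : ∀ i, Function.Exact (δ i) (a (i + 1))

namespace LongExactSequence

variable (L : LongExactSequence.{u})

/-- All terms of the long exact sequence are finite-dimensional, and those of degree `> n`
vanish. -/
structure IsFinite (n : ℕ) : Prop where
  finA : ∀ i, FiniteDimensional ℂ (L.A i)
  finB : ∀ i, FiniteDimensional ℂ (L.B i)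
  finC : ∀ i, FiniteDimensional ℂ (L.C i)
  zeroA : ∀ i, n < i → Subsingleton (L.A i)
  zeroB : ∀ i, n < i → Subsingleton (L.B i)
  zeroC : ∀ i, n < i → Subsingleton (L.C i)

/-- The rank of the connecting map that ends in degree `i`, where `r i` is the rank of the one that
starts in degree `i`. -/
def prev (r : ℕ → ℕ) : ℕ → ℕ
  | 0 => 0
  | i + 1 => r i

/-- Bases of the terms of a long exact sequence that are adapted to its maps: in each term, the
last vectors of the basis project to a basis of the cokernel of the incoming map, and the first
ones are the images under the incoming map of the last basis vectors of the preceding term. -/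
structure AdaptedBases where
  p : ℕ → ℕ
  q : ℕ → ℕ
  r : ℕ → ℕ
  basisA : ∀ i, Module.Basis (Fin (prev r i + p i)) ℂ (L.A i)
  basisB : ∀ i, Module.Basis (Fin (p i + q i)) ℂ (L.B i)
  basisC : ∀ i, Module.Basis (Fin (q i + r i)) ℂ (L.C i)
  map_a : ∀ i (j : Fin (p i)),
    basisB i (Fin.castAdd (q i) j) = L.a i (basisA i (Fin.natAdd (prev r i) j))
  map_b : ∀ i (j : Fin (q i)),
    basisC i (Fin.castAdd (r i) j) = L.b i (basisB i (Fin.natAdd (p i) j))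
  map_δ : ∀ i (j : Fin (r i)),
    basisA (i + 1) (Fin.castAdd (p (i + 1)) j) = L.δ i (basisC i (Fin.natAdd (q i) j))

/-- The isomorphism of lines `det C ⊗ det A ≅ det B` defined by adapted bases of a long exact
sequence: it maps the tensor product of the generators defined by the bases to the generator
defined by the bases. In other words, it is the isomorphism defined by the canonical element
`⨂_i (∧ basis of A^i)^{(-1)^i} ⊗ (∧ basis of B^i)^{-(-1)^i} ⊗ (∧ basis of C^i)^{(-1)^i}`
of the determinant line of the long exact sequence, viewed as an acyclic complex. -/
noncomputable def AdaptedBases.detIso {L : LongExactSequence.{u}} (D : L.AdaptedBases) (n : ℕ) :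
    GradedDet n L.C ⊗[ℂ] GradedDet n L.A ≃ₗ[ℂ] GradedDet n L.B where
  toFun x := LinearMap.mul' ℂ ℂ (TensorProduct.map (gradedVolCoord n D.basisC)
    (gradedVolCoord n D.basisA) x) • gradedVol n D.basisB
  map_add' x y := by rw [map_add, map_add, add_smul]
  map_smul' c x := by rw [map_smul, map_smul, smul_assoc, RingHom.id_apply]
  invFun y := gradedVolCoord n D.basisB y •
    (gradedVol n D.basisC ⊗ₜ[ℂ] gradedVol n D.basisA)
  left_inv x := by
    dsimp only
    rw [map_smul, gradedVolCoord_gradedVol, smul_eq_mul, mul_one]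
    induction x with
    | zero => rw [map_zero, map_zero, zero_smul]
    | add x y hx hy => rw [map_add, map_add, add_smul, hx, hy]
    | tmul x y =>
      conv_rhs => rw [← gradedVolCoord_smul_gradedVol n D.basisC x,
        ← gradedVolCoord_smul_gradedVol n D.basisA y]
      rw [TensorProduct.map_tmul, LinearMap.mul'_apply, TensorProduct.smul_tmul_smul]
  right_inv y := by
    dsimp only
    rw [map_smul, map_smul, TensorProduct.map_tmul, LinearMap.mul'_apply,
      gradedVolCoord_gradedVol, gradedVolCoord_gradedVol, mul_one, smul_eq_mul, mul_one,
      gradedVolCoord_smul_gradedVol]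

theorem AdaptedBases.detIso_gradedVol {L : LongExactSequence.{u}} (D : L.AdaptedBases) (n : ℕ) :
    D.detIso n (gradedVol n D.basisC ⊗ₜ[ℂ] gradedVol n D.basisA) = gradedVol n D.basisB := by
  change LinearMap.mul' ℂ ℂ (TensorProduct.map (gradedVolCoord n D.basisC)
    (gradedVolCoord n D.basisA) _) • gradedVol n D.basisB = _
  rw [TensorProduct.map_tmul, LinearMap.mul'_apply, gradedVolCoord_gradedVol,
    gradedVolCoord_gradedVol, mul_one, one_smul]

theorem exists_lift_basis_range {V W : Type u} [AddCommGroup V] [Module ℂ V] [AddCommGroup W]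
    [Module ℂ W] [FiniteDimensional ℂ V] (f : V →ₗ[ℂ] W) :
    ∃ v : Fin (Module.finrank ℂ (LinearMap.range f)) → V,
      LinearIndependent ℂ (f ∘ v) ∧ Submodule.span ℂ (range (f ∘ v)) = LinearMap.range f := by
  let e := Module.finBasis ℂ (LinearMap.range f)
  choose v hv using fun i => (e i).2
  have h : f ∘ v = (LinearMap.range f).subtype ∘ e := funext hv
  refine ⟨v, ?_, ?_⟩
  · rw [h]
    exact e.linearIndependent.map' _ (Submodule.ker_subtype _)
  · rw [h, range_comp, ← Submodule.map_span, e.span_eq, Submodule.map_subtype_top]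

theorem exists_basis_append {V W : Type u} [AddCommGroup V] [Module ℂ V] [AddCommGroup W]
    [Module ℂ W] (f : V →ₗ[ℂ] W) {k l : ℕ} (u : Fin k → V) (v : Fin l → V)
    (hu : LinearIndependent ℂ u) (hu' : Submodule.span ℂ (range u) = LinearMap.ker f)
    (hv : LinearIndependent ℂ (f ∘ v))
    (hv' : Submodule.span ℂ (range (f ∘ v)) = LinearMap.range f) :
    ∃ b : Module.Basis (Fin (k + l)) ℂ V,
      (∀ j, b (Fin.castAdd l j) = u j) ∧ ∀ j, b (Fin.natAdd k j) = v j := by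
  have hdisj : Disjoint (Submodule.span ℂ (range u)) (Submodule.span ℂ (range v)) := by
    rw [hu', disjoint_comm]
    exact Submodule.range_ker_disjoint hv
  have hli : LinearIndependent ℂ (Sum.elim u v) := (hu.sum_type (hv.of_comp f) hdisj)
  have hsp : ⊤ ≤ Submodule.span ℂ (range (Sum.elim u v)) := by
    intro x _
    rw [Sum.elim_range, Submodule.span_union, hu']
    have hx : f x ∈ Submodule.map f (Submodule.span ℂ (range v)) := by
      rw [Submodule.map_span, ← range_comp, hv']
      exact ⟨x, rfl⟩
    obtain ⟨y, hy, hyx⟩ := hx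
    refine Submodule.mem_sup.2 ⟨x - y, ?_, y, hy, sub_add_cancel x y⟩
    rw [LinearMap.mem_ker, map_sub, hyx, sub_self]
  refine ⟨(Module.Basis.mk hli hsp).reindex finSumFinEquiv, fun j => ?_, fun j => ?_⟩
  · simp
  · simp

theorem nonempty_adaptedBases {L : LongExactSequence.{u}} {n : ℕ} (h : L.IsFinite n) :
    Nonempty L.AdaptedBases := by
  have := h.finA
  have := h.finB
  have := h.finC
  choose va hva hva' using fun i => exists_lift_basis_range (L.a i)
  choose vb hvb hvb' using fun i => exists_lift_basis_range (L.b i)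
  choose vc hvc hvc' using fun i => exists_lift_basis_range (L.δ i)
  let p : ℕ → ℕ := fun i => Module.finrank ℂ (LinearMap.range (L.a i))
  let q : ℕ → ℕ := fun i => Module.finrank ℂ (LinearMap.range (L.b i))
  let r : ℕ → ℕ := fun i => Module.finrank ℂ (LinearMap.range (L.δ i))
  have hA0 : ∃ b : Module.Basis (Fin (0 + p 0)) ℂ (L.A 0), ∀ j, b (Fin.natAdd 0 j) = va 0 j := by
    obtain ⟨b, -, hb⟩ := exists_basis_append (L.a 0) (Fin.elim0 : Fin 0 → L.A 0) (va 0)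
      linearIndependent_empty_type
      (by rw [range_eq_empty, Submodule.span_empty, LinearMap.ker_eq_bot.2 L.injective_a])
      (hva 0) (hva' 0)
    exact ⟨b, hb⟩
  obtain ⟨bA0, hbA0⟩ := hA0
  choose bA hbA hbA' using fun i => exists_basis_append (L.a (i + 1)) (L.δ i ∘ vc i) (va (i + 1))
    (hvc i) ((hvc' i).trans (L.exact_δ_a i).linearMap_ker_eq.symm) (hva (i + 1)) (hva' (i + 1))
  choose bB hbB hbB' using fun i => exists_basis_append (L.b i) (L.a i ∘ va i) (vb i)
    (hva i) ((hva' i).trans (L.exact_a_b i).linearMap_ker_eq.symm) (hvb i) (hvb' i)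
  choose bC hbC hbC' using fun i => exists_basis_append (L.δ i) (L.b i ∘ vb i) (vc i)
    (hvb i) ((hvb' i).trans (L.exact_b_δ i).linearMap_ker_eq.symm) (hvc i) (hvc' i)
  let basA : ∀ i, Module.Basis (Fin (prev r i + p i)) ℂ (L.A i) := fun i =>
    match i with
    | 0 => bA0
    | i + 1 => bA i
  have hbasA : ∀ i j, basA i (Fin.natAdd (prev r i) j) = va i j := by
    intro i j
    cases i with
    | zero => exact hbA0 j
    | succ i => exact hbA' i j
  exact ⟨{
    p := p
    q := q
    r := r
    basisA := basA
    basisB := bB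
    basisC := bC
    map_a := fun i j => (hbB i j).trans (congrArg (L.a i) (hbasA i j)).symm
    map_b := fun i j => (hbC i j).trans (congrArg (L.b i) (hbB' i j)).symm
    map_δ := fun i j => (hbA i j).trans (congrArg (L.δ i) (hbC' i j)).symm }⟩

open Classical in
/-- The canonical isomorphism of lines `det C ⊗ det A ≅ det B` associated with a long exact sequence
of finite-dimensional vector spaces that vanish in degrees `> n`, computed with any adapted bases.
(Like every function it is total: it is set to `0` if one of the vector spaces is
infinite-dimensional or does not vanish in some degree `> n`.) -/
noncomputable def detMap (n : ℕ) :
    GradedDet n L.C ⊗[ℂ] GradedDet n L.A →ₗ[ℂ] GradedDet n L.B :=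
  if h : L.IsFinite n then ((nonempty_adaptedBases h).some.detIso n).toLinearMap else 0

theorem detMap_bijective {n : ℕ} (h : L.IsFinite n) : Function.Bijective (L.detMap n) := by
  rw [detMap, dif_pos h]
  exact ((nonempty_adaptedBases h).some.detIso n).bijective

end LongExactSequence

end Determinant

namespace FlatVectorBundle

universe u

variable {X : Type u} [TopologicalSpace X] {r : ℕ} {ι : Type*} (F : FlatVectorBundle X r ι)

/-- The long exact cohomology sequence of a triple `P ⊆ Q ⊆ R`,
`⋯ → H^i(R, Q; F) → H^i(R, P; F) → H^i(Q, P; F) → H^{i+1}(R, Q; F) → ⋯`. -/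
noncomputable def longExactSequence {P Q R : Set X} (hPQ : P ⊆ Q) (hQR : Q ⊆ R) :
    LongExactSequence.{u} where
  A := F.cohomology R Q
  B := F.cohomology R P
  C := F.cohomology Q P
  a i := (HomologicalComplex.homologyMap (F.complexIncl R hPQ) i).hom
  b i := (HomologicalComplex.homologyMap (F.complexRestr hQR P) i).hom
  δ i := ((F.tripleSequence_shortExact hPQ hQR).δ i (i + 1) rfl).hom
  injective_a := by
    have := (F.tripleSequence_shortExact hPQ hQR).mono_f
    have : Mono (F.complexIncl R hPQ) := this
    have : Mono (HomologicalComplex.homologyMap (F.complexIncl R hPQ) 0) :=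
      HomologicalComplex.mono_homologyMap_of_mono_of_not_rel _ 0 (by simp)
    exact (ModuleCat.mono_iff_injective _).1 this
  exact_a_b i := (ShortComplex.ShortExact.moduleCat_exact_iff_function_exact _).1
    ((F.tripleSequence_shortExact hPQ hQR).homology_exact₂ i)
  exact_b_δ i := (ShortComplex.ShortExact.moduleCat_exact_iff_function_exact _).1
    ((F.tripleSequence_shortExact hPQ hQR).homology_exact₃ i (i + 1) rfl)
  exact_δ_a i := (ShortComplex.ShortExact.moduleCat_exact_iff_function_exact _).1
    ((F.tripleSequence_shortExact hPQ hQR).homology_exact₁ i (i + 1) rfl)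

/-- The canonical isomorphism `det H(Q, P; F) ⊗ det H(R, Q; F) ≅ det H(R, P; F)` given by the
long exact cohomology sequence of a triple `P ⊆ Q ⊆ R`, the cohomology being concentrated in
degrees `0, …, n`. -/
noncomputable def fusion (n : ℕ) {P Q R : Set X} (hPQ : P ⊆ Q) (hQR : Q ⊆ R) :
    GradedDet n (F.cohomology Q P) ⊗[ℂ] GradedDet n (F.cohomology R Q) →ₗ[ℂ]
      GradedDet n (F.cohomology R P) :=
  (F.longExactSequence hPQ hQR).detMap n

end FlatVectorBundle

/-!
The four long exact sequences of a filtration `P ⊆ Q ⊆ R ⊆ S` form a braid, and the six graded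
cohomology spaces have bases adapted to all four sequences at once: an exact braid is a sum of
elementary ones, in which a single vector runs through consecutive spots. In these bases every
fusion isomorphism sends the product of two generators to the third one, up to the sign of the
permutations that reorder the bases, and the two composites therefore agree up to sign. That any
adapted bases compute the fusion isomorphism is the multiplicativity of determinants: two systems
of adapted bases differ by an automorphism of the long exact sequence, and its alternating
determinants telescope.
-/

section Sign

variable {M N : Type*} [AddCommGroup M] [AddCommGroup N]

/-- Equality up to sign in an abelian group: the relation in which two generators of a determinant
line stand when the bases defining them differ only by a reordering. -/
def EqUpToSign (x y : M) : Prop :=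
  ∃ ε : ℤˣ, x = ε • y

namespace EqUpToSign

variable {x y z : M}

theorem symm (h : EqUpToSign x y) : EqUpToSign y x := by
  obtain ⟨ε, rfl⟩ := h
  exact ⟨ε⁻¹, (inv_smul_smul ε y).symm⟩

theorem trans (hxy : EqUpToSign x y) (hyz : EqUpToSign y z) : EqUpToSign x z := by
  obtain ⟨ε, rfl⟩ := hxy
  obtain ⟨η, rfl⟩ := hyz
  exact ⟨ε * η, (mul_smul ε η z).symm⟩

theorem map {F : Type*} [FunLike F M N] [AddMonoidHomClass F M N] (f : F) (h : EqUpToSign x y) :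
    EqUpToSign (f x) (f y) := by
  obtain ⟨ε, rfl⟩ := h
  exact ⟨ε, map_zsmul f (ε : ℤ) y⟩

theorem tmul {R : Type*} [CommRing R] [Module R M] [Module R N] {x' y' : N}
    (h : EqUpToSign x y) (h' : EqUpToSign x' y') : EqUpToSign (x ⊗ₜ[R] x') (y ⊗ₜ[R] y') :=
  (h.map ((TensorProduct.mk R M N).flip x')).trans (h'.map (TensorProduct.mk R M N y))

theorem exists_norm_eq_one_and_eq_smul (𝕜 : Type*) [NormedRing 𝕜] [NormOneClass 𝕜] [Module 𝕜 M]
    (h : EqUpToSign x y) : ∃ μ : 𝕜, ‖μ‖ = 1 ∧ x = μ • y := by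
  obtain ⟨ε, rfl⟩ := h
  refine ⟨(ε : ℤ), ?_, (Int.cast_smul_eq_zsmul 𝕜 (ε : ℤ) y).symm⟩
  rcases Int.units_eq_one_or ε with rfl | rfl <;> simp

end EqUpToSign

end Sign

section Basis

variable {K V W Z : Type*} [Ring K] [AddCommGroup V] [Module K V] [AddCommGroup W] [Module K W]
  [AddCommGroup Z] [Module K Z] {ι κ μ ν : Type*}

/-- The family `v` of vectors of `V` is a basis of the submodule `N`. This unbundled notion is the
convenient one for a submodule that is described in several ways. -/
def IsBasisOf (v : ι → V) (N : Submodule K V) : Prop :=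
  LinearIndependent K v ∧ Submodule.span K (range v) = N

namespace IsBasisOf

theorem mem {v : ι → V} {N : Submodule K V} (hv : IsBasisOf v N) (j : ι) : v j ∈ N :=
  hv.2 ▸ Submodule.subset_span (mem_range_self j)

theorem isEmpty [Nontrivial K] {v : ι → V} (hv : IsBasisOf v (⊥ : Submodule K V)) : IsEmpty ι :=
  ⟨fun j => hv.1.ne_zero j ((Submodule.mem_bot K).1 (hv.mem j))⟩

/-- The basis of the whole module defined by a family that is a basis of `⊤`. -/
noncomputable def basis {v : ι → V} (hv : IsBasisOf v (⊤ : Submodule K V)) : Module.Basis ι K V :=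
  Module.Basis.mk hv.1 hv.2.ge

@[simp]
theorem coe_basis {v : ι → V} (hv : IsBasisOf v (⊤ : Submodule K V)) : ⇑hv.basis = v :=
  Module.Basis.coe_mk _ _

theorem sumElim {N N' : Submodule K V} (f : V →ₗ[K] W) {u : ι → V} {v : κ → V}
    (hu : IsBasisOf u N') (hN' : N ⊓ LinearMap.ker f = N') (hvN : ∀ j, v j ∈ N)
    (hv : IsBasisOf (fun j => f (v j)) (N.map f)) : IsBasisOf (Sum.elim u v) N := by
  obtain ⟨hvi : LinearIndependent K (f ∘ v), hvs : Submodule.span K (range (f ∘ v)) = N.map f⟩ := hv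
  have hvN : Submodule.span K (range v) ≤ N := Submodule.span_le.2 (range_subset_iff.2 hvN)
  subst hN'
  refine ⟨hu.1.sum_type (hvi.of_comp f) ?_, ?_⟩
  · exact (Submodule.range_ker_disjoint hvi).symm.mono_left (hu.2.trans_le inf_le_right)
  rw [Sum.elim_range, Submodule.span_union, hu.2]
  refine le_antisymm (sup_le inf_le_left hvN) fun x hx => ?_
  obtain ⟨y, hy, hyx⟩ : f x ∈ (Submodule.span K (range v)).map f := by
    rw [Submodule.map_span, ← range_comp, hvs]
    exact ⟨x, hx, rfl⟩
  refine Submodule.mem_sup.2 ⟨x - y, ⟨N.sub_mem hx (hvN hy), ?_⟩, y, hy, sub_add_cancel x y⟩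
  rw [SetLike.mem_coe, LinearMap.mem_ker, map_sub, hyx, sub_self]

theorem sumElim_top {N : Submodule K V} (f : V →ₗ[K] W) {u : ι → V} {v : κ → V}
    (hu : IsBasisOf u N) (hN : LinearMap.ker f = N) (hv : IsBasisOf (fun j => f (v j)) f.range) :
    IsBasisOf (Sum.elim u v) (⊤ : Submodule K V) :=
  hu.sumElim f (by rw [top_inf_eq, hN]) (fun _ => trivial) (by rwa [Submodule.map_top])

/-- The filtration `ker f ≤ ker k ≤ V` attached to a factorization `k = g ∘ f`. -/
theorem of_comp {W' Z' : Type*} [AddCommGroup W'] [Module K W'] [AddCommGroup Z'] [Module K Z']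
    {f : V →ₗ[K] W} {g : W →ₗ[K] Z} {g' : W →ₗ[K] W'} {k : V →ₗ[K] Z} {h : Z →ₗ[K] Z'}
    (hgf : ∀ x, g (f x) = k x) (hf : Function.Exact f g') (hk : Function.Exact k h)
    {u : ι → V} {v : κ → V} {w : μ → V} (hu : IsBasisOf u f.ker)
    (hv : IsBasisOf (fun j => f (v j)) (g.ker ⊓ g'.ker))
    (hw : IsBasisOf (fun j => k (w j)) h.ker) :
    IsBasisOf (Sum.elim (Sum.elim u v) w) (⊤ : Submodule K V) := by
  obtain rfl : g ∘ₗ f = k := LinearMap.ext hgf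
  refine (hu.sumElim (N := (g ∘ₗ f).ker) f ?_ (fun j => (hv.mem j).1) ?_).sumElim_top (g ∘ₗ f)
    rfl (by rwa [← hk.linearMap_ker_eq])
  · exact inf_eq_right.2 (f.ker_le_ker_comp g)
  · rwa [LinearMap.ker_comp, Submodule.map_comap_eq, ← hf.linearMap_ker_eq, inf_comm]

/-- The filtration `ker g ⊓ ker g' ≤ ker g' ≤ ker (k ∘ g) ≤ V` attached to a commutative square
`k ∘ g = k' ∘ g'`. -/
theorem of_square {W' : Type*} [AddCommGroup W'] [Module K W'] {g : V →ₗ[K] W} {g' : V →ₗ[K] W'}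
    {k : W →ₗ[K] Z} {k' : W' →ₗ[K] Z} (hk : ∀ x, k (g x) = k' (g' x))
    {u : ι → V} {v : κ → V} {w : μ → V} {x : ν → V}
    (hu : IsBasisOf u (g.ker ⊓ g'.ker))
    (hv' : ∀ j, g' (v j) = 0) (hv : IsBasisOf (fun j => g (v j)) k.ker)
    (hw' : ∀ j, g (w j) = 0) (hw : IsBasisOf (fun j => g' (w j)) k'.ker)
    (hx : IsBasisOf (fun j => k (g (x j))) (k ∘ₗ g).range) :
    IsBasisOf (Sum.elim (Sum.elim (Sum.elim u v) w) x) (⊤ : Submodule K V) := by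
  have hker : k.ker = (g'.ker).map g := by
    refine le_antisymm ?_ ?_
    · rw [← hv.2, Submodule.span_le, range_subset_iff]
      exact fun j => ⟨v j, hv' j, rfl⟩
    · rintro _ ⟨y, hy, rfl⟩
      rw [LinearMap.mem_ker, hk, hy, map_zero]
  have hker' : k'.ker = ((k ∘ₗ g).ker).map g' := by
    refine le_antisymm ?_ ?_
    · rw [← hw.2, Submodule.span_le, range_subset_iff]
      exact fun j => ⟨w j, by simp [hw'], rfl⟩
    · rintro _ ⟨y, hy, rfl⟩
      exact (hk y).symm.trans hy
  refine ((hu.sumElim (N := g'.ker) g (inf_comm _ _) hv' (hker ▸ hv)).sumElim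
    (N := (k ∘ₗ g).ker) g' ?_ (fun j => by simp [hw']) (hker' ▸ hw)).sumElim_top (k ∘ₗ g) rfl hx
  refine inf_eq_right.2 fun y hy => ?_
  rw [LinearMap.mem_ker, LinearMap.comp_apply, hk, hy, map_zero]

end IsBasisOf

end Basis

universe u

section Volume

variable {W : Type u} [AddCommGroup W] [Module ℂ W]

theorem vol_eq_of_wedge_eq {m m' : ℕ} {b : Module.Basis (Fin m) ℂ W}
    {b' : Module.Basis (Fin m') ℂ W} {c : ℂˣ} (h : wedge b' = c • wedge b) (s : Bool) :
    vol b' s = c ^ (bif s then -1 else 1 : ℤ) • vol b s := by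
  cases s with
  | false => exact h.trans (congrArg (· • wedge b) (zpow_one c).symm)
  | true =>
    refine LinearMap.ext fun y => ?_
    have hb : wedgeInv b (wedge b') = c := by
      rw [h, Units.smul_def, map_smul, wedgeInv_wedge, smul_eq_mul, mul_one]
    have hy : wedgeInv b y = wedgeInv b' y * c := by
      conv_lhs => rw [← wedgeInv_smul_wedge b' y]
      rw [map_smul, hb, smul_eq_mul]
    change wedgeInv b' y = c ^ (-1 : ℤ) • wedgeInv b y
    rw [hy, zpow_neg_one, mul_comm, Units.smul_def, smul_eq_mul, Units.inv_mul_cancel_left]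

theorem wedge_map {m : ℕ} (b : Module.Basis (Fin m) ℂ W) (g : W ≃ₗ[ℂ] W) :
    wedge (b.map g) = LinearEquiv.det g • wedge b := by
  have hdet : wedgeInv b (wedge (b.map g)) = LinearEquiv.det g := by
    have hg : ⇑(basisFinrank (b.map g)) = (g : W →ₗ[ℂ] W) ∘ basisFinrank b :=
      funext fun j => by simp [basisFinrank]
    rw [wedgeInv, wedge, exteriorPower.alternatingMapLinearEquiv_apply_ιMulti, hg,
      Module.Basis.det_comp, Module.Basis.det_self, mul_one, LinearEquiv.coe_det]
  rw [← wedgeInv_smul_wedge b (wedge (b.map g)), hdet, Units.smul_def]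

theorem eqUpToSign_wedge_reindex {κ : Type*} {m m' : ℕ} (b : Module.Basis κ ℂ W) (e : κ ≃ Fin m)
    (e' : κ ≃ Fin m') : EqUpToSign (wedge (b.reindex e)) (wedge (b.reindex e')) := by
  obtain rfl : m = m' := Fin.equiv_iff_eq.1 ⟨e.symm.trans e'⟩
  let c : Fin m ≃ Fin (Module.finrank ℂ W) :=
    finCongr ((Module.finrank_eq_card_basis (b.reindex e)).trans (Fintype.card_fin m)).symm
  let σ := c.symm.trans ((e.symm.trans e').trans c)
  have hσ : ⇑(basisFinrank (b.reindex e)) = basisFinrank (b.reindex e') ∘ σ :=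
    funext fun j => by simp [basisFinrank, σ, c]
  refine ⟨Equiv.Perm.sign σ, ?_⟩
  rw [wedge, hσ]
  exact AlternatingMap.map_perm _ _ σ

theorem eqUpToSign_vol_reindex {κ : Type*} {m m' : ℕ} (b : Module.Basis κ ℂ W) (e : κ ≃ Fin m)
    (e' : κ ≃ Fin m') (s : Bool) : EqUpToSign (vol (b.reindex e) s) (vol (b.reindex e') s) := by
  obtain ⟨ε, hε⟩ := eqUpToSign_wedge_reindex b e e'
  have hc : wedge (b.reindex e) =
      Units.map (Int.castRingHom ℂ : ℤ →* ℂ) ε • wedge (b.reindex e') := by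
    rw [hε, Units.smul_def, Units.smul_def]
    exact (Int.cast_smul_eq_zsmul ℂ _ _).symm
  refine ⟨ε, (vol_eq_of_wedge_eq hc s).trans ?_⟩
  have hinv : ε ^ (bif s then -1 else 1 : ℤ) = ε := by cases s <;> simp
  rw [← map_zpow, hinv, Units.smul_def, Units.smul_def]
  exact Int.cast_smul_eq_zsmul ℂ _ _

end Volume

theorem EqUpToSign.map_multilinear {R ι N : Type*} {M : ι → Type*} [CommRing R] [Finite ι]
    [∀ i, AddCommGroup (M i)] [∀ i, Module R (M i)] [AddCommGroup N] [Module R N]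
    (f : MultilinearMap R M N) {x y : ∀ i, M i} (h : ∀ i, EqUpToSign (x i) (y i)) :
    EqUpToSign (f x) (f y) := by
  have := Fintype.ofFinite ι
  choose ε hε using h
  refine ⟨∏ i, ε i, ?_⟩
  rw [funext hε, Units.smul_def, Units.coe_prod]
  exact (f.restrictScalars ℤ).map_smul_univ (fun i => (ε i : ℤ)) y

section GradedVolume

variable {E : ℕ → ModuleCat.{u} ℂ} (n : ℕ)

/-- The alternating product `∏ (det gᵢ)^{(-1)^i}`, by which an automorphism `g` of a graded vector
space `E` concentrated in degrees `0, …, n` acts on the line `det E`. -/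
noncomputable def alternatingDet (g : ∀ i, E i ≃ₗ[ℂ] E i) : ℂˣ :=
  ∏ i ∈ Finset.range (n + 1), LinearEquiv.det (g i) ^ ((-1 : ℤ) ^ i)

theorem gradedVol_map {m : ℕ → ℕ} (b : ∀ i, Module.Basis (Fin (m i)) ℂ (E i))
    (g : ∀ i, E i ≃ₗ[ℂ] E i) :
    gradedVol n (fun i => (b i).map (g i)) = alternatingDet n g • gradedVol n b := by
  have hsign (i : ℕ) : (bif i.bodd then -1 else 1 : ℤ) = (-1) ^ i := by
    induction i with
    | zero => rfl
    | succ i ih => rw [Nat.bodd_succ, pow_succ, ← ih]; cases i.bodd <;> rfl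
  have hvol (i : Fin (n + 1)) := vol_eq_of_wedge_eq (wedge_map (b i) (g i)) (i : ℕ).bodd
  simp only [hsign, Units.smul_def] at hvol
  rw [gradedVol, funext hvol, MultilinearMap.map_smul_univ, gradedVol, alternatingDet,
    Finset.prod_range, Units.smul_def, Units.coe_prod]

/-- The generator of `det E` defined by bases of the `E^i` with arbitrary finite index types. The
enumeration of these types is an arbitrary choice, so only the class of `enumVol n b` up to sign is
meaningful. -/
noncomputable def enumVol {κ : ℕ → Type*} [∀ i, Fintype (κ i)]
    (b : ∀ i, Module.Basis (κ i) ℂ (E i)) : GradedDet n E :=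
  gradedVol n fun i => (b i).reindex (Fintype.equivFin (κ i))

theorem eqUpToSign_gradedVol_enumVol {κ : ℕ → Type*} [∀ i, Fintype (κ i)] {m : ℕ → ℕ}
    (b : ∀ i, Module.Basis (κ i) ℂ (E i)) (e : ∀ i, κ i ≃ Fin (m i)) :
    EqUpToSign (gradedVol n fun i => (b i).reindex (e i)) (enumVol n b) :=
  EqUpToSign.map_multilinear _ fun i : Fin (n + 1) => eqUpToSign_vol_reindex (b i) (e i) _ _

theorem enumVol_generates {κ : ℕ → Type*} [∀ i, Fintype (κ i)]
    (b : ∀ i, Module.Basis (κ i) ℂ (E i)) (x : GradedDet n E) : ∃ t : ℂ, t • enumVol n b = x :=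
  ⟨_, gradedVolCoord_smul_gradedVol n _ x⟩

end GradedVolume

section ExactDeterminant

variable {K V W Z : Type*} [Field K] [AddCommGroup V] [Module K V] [AddCommGroup W] [Module K W]
  [AddCommGroup Z] [Module K Z]

/-- The automorphism of the kernel of `f` induced by an automorphism `(g, k)` of the map `f`. -/
noncomputable def kerAut {f : V →ₗ[K] W} (g : V ≃ₗ[K] V) (k : W ≃ₗ[K] W)
    (h : ∀ x, f (g x) = k (f x)) : f.ker ≃ₗ[K] f.ker :=
  g.ofSubmodules f.ker f.ker <| by
    refine Submodule.ext fun x => ⟨?_, fun hx => ⟨g.symm x, ?_, g.apply_symm_apply x⟩⟩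
    · rintro ⟨y, hy : f y = 0, rfl⟩
      exact (h y).trans (by rw [hy, map_zero])
    · refine k.injective ((h _).symm.trans ?_)
      rw [g.apply_symm_apply, map_zero]
      exact hx

theorem det_eq_det_kerAut_mul_det_kerAut [FiniteDimensional K V] {f : V →ₗ[K] W} {f' : W →ₗ[K] Z}
    (hf : Function.Exact f f') {g : V ≃ₗ[K] V} {k : W ≃ₗ[K] W} {l : Z ≃ₗ[K] Z}
    (h : ∀ x, f (g x) = k (f x)) (h' : ∀ y, f' (k y) = l (f' y)) :
    LinearEquiv.det g = LinearEquiv.det (kerAut g k h) * LinearEquiv.det (kerAut k l h') := by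
  have hker : f.ker ≤ f.ker.comap (g : V →ₗ[K] V) := fun x hx => (kerAut g k h ⟨x, hx⟩).2
  let e : (V ⧸ f.ker) ≃ₗ[K] f'.ker :=
    f.quotKerEquivRange.trans (LinearEquiv.ofEq _ _ hf.linearMap_ker_eq.symm)
  have hconj : e.toLinearMap ∘ₗ f.ker.mapQ f.ker (g : V →ₗ[K] V) hker ∘ₗ e.symm.toLinearMap =
      (kerAut k l h').toLinearMap := by
    rw [← LinearMap.comp_assoc, LinearEquiv.comp_toLinearMap_symm_eq]
    refine LinearMap.ext fun q => Subtype.ext ?_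
    obtain ⟨x, rfl⟩ := Submodule.mkQ_surjective _ q
    exact h x
  refine Units.ext ?_
  rw [Units.val_mul, LinearEquiv.coe_det, LinearEquiv.coe_det, LinearEquiv.coe_det, ← hconj,
    LinearMap.det_conj, LinearMap.det_eq_det_mul_det f.ker _ hker]
  rfl

end ExactDeterminant

/-- For an automorphism of a long exact sequence `⋯ → A i → B i → C i → ⋯`, read `x`, `y` and `z` as
its determinants on the kernels of the three maps. -/
theorem prod_zpow_neg_one_pow_mul {G : Type*} [CommGroup G] {A B C x y z : ℕ → G} (n : ℕ)
    (hA : ∀ i, A i = x i * y i) (hB : ∀ i, B i = y i * z i) (hC : ∀ i, C i = z i * x (i + 1))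
    (hx₀ : x 0 = 1) (hxn : x (n + 1) = 1) :
    (∏ i ∈ Finset.range (n + 1), C i ^ ((-1 : ℤ) ^ i)) *
        ∏ i ∈ Finset.range (n + 1), A i ^ ((-1 : ℤ) ^ i) =
      ∏ i ∈ Finset.range (n + 1), B i ^ ((-1 : ℤ) ^ i) := by
  let w i := x i ^ ((-1 : ℤ) ^ i)
  have hw i : C i ^ ((-1 : ℤ) ^ i) * A i ^ ((-1 : ℤ) ^ i) =
      w i / w (i + 1) * B i ^ ((-1 : ℤ) ^ i) := by
    simp only [w, pow_succ, mul_neg_one, zpow_neg, div_inv_eq_mul, ← mul_zpow]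
    rw [hA, hB, hC]
    congr 1
    ac_rfl
  rw [← Finset.prod_mul_distrib, Finset.prod_congr rfl fun i _ => hw i, Finset.prod_mul_distrib,
    Finset.prod_range_div']
  simp [w, hx₀, hxn]

namespace LongExactSequence

variable {L : LongExactSequence.{u}}

variable (L) in
/-- An automorphism of a long exact sequence. Any two systems of adapted bases with the same ranks
are related by one. -/
structure Automorphism where
  autA : ∀ i, L.A i ≃ₗ[ℂ] L.A i
  autB : ∀ i, L.B i ≃ₗ[ℂ] L.B i
  autC : ∀ i, L.C i ≃ₗ[ℂ] L.C i
  comm_a : ∀ i x, L.a i (autA i x) = autB i (L.a i x)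
  comm_b : ∀ i x, L.b i (autB i x) = autC i (L.b i x)
  comm_δ : ∀ i x, L.δ i (autC i x) = autA (i + 1) (L.δ i x)

theorem Automorphism.alternatingDet_mul (g : L.Automorphism) {n : ℕ} (hL : L.IsFinite n) :
    alternatingDet n g.autC * alternatingDet n g.autA = alternatingDet n g.autB := by
  have := hL.finA
  have := hL.finB
  have := hL.finC
  have := hL.zeroA
  have hx (i : ℕ) (h : Subsingleton (L.a i).ker) :
      LinearEquiv.det (kerAut (g.autA i) (g.autB i) (g.comm_a i)) = 1 :=
    Units.ext ((LinearEquiv.coe_det _).trans (LinearMap.det_eq_one_of_subsingleton _))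
  refine prod_zpow_neg_one_pow_mul n
    (fun i => det_eq_det_kerAut_mul_det_kerAut (L.exact_a_b i) (g.comm_a i) (g.comm_b i))
    (fun i => det_eq_det_kerAut_mul_det_kerAut (L.exact_b_δ i) (g.comm_b i) (g.comm_δ i))
    (fun i => det_eq_det_kerAut_mul_det_kerAut (L.exact_δ_a i) (g.comm_δ i) (g.comm_a (i + 1)))
    (hx 0 ?_) (hx (n + 1) ?_)
  · rw [LinearMap.ker_eq_bot.2 L.injective_a]
    infer_instance
  · have := hL.zeroA (n + 1) n.lt_succ_self
    infer_instance

namespace AdaptedBases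

/-- The image of adapted bases under an automorphism of the long exact sequence. -/
noncomputable def map (D : L.AdaptedBases) (g : L.Automorphism) : L.AdaptedBases where
  p := D.p
  q := D.q
  r := D.r
  basisA i := (D.basisA i).map (g.autA i)
  basisB i := (D.basisB i).map (g.autB i)
  basisC i := (D.basisC i).map (g.autC i)
  map_a i j := by simp [D.map_a, g.comm_a]
  map_b i j := by simp [D.map_b, g.comm_b]
  map_δ i j := by simp [D.map_δ, g.comm_δ]

theorem detIso_map (D : L.AdaptedBases) (g : L.Automorphism) {n : ℕ} (hL : L.IsFinite n) :
    (D.map g).detIso n = D.detIso n := by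
  have hvol : D.detIso n (gradedVol n (D.map g).basisC ⊗ₜ gradedVol n (D.map g).basisA) =
      gradedVol n (D.map g).basisB := by
    change D.detIso n (gradedVol n (fun i => (D.basisC i).map (g.autC i)) ⊗ₜ
      gradedVol n (fun i => (D.basisA i).map (g.autA i))) =
      gradedVol n (fun i => (D.basisB i).map (g.autB i))
    simp only [gradedVol_map, Units.smul_def, TensorProduct.smul_tmul_smul, map_smul,
      detIso_gradedVol]
    rw [← Units.val_mul, g.alternatingDet_mul hL]
  refine LinearEquiv.toLinearMap_injective (TensorProduct.ext' fun x y => ?_)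
  rw [← gradedVolCoord_smul_gradedVol n (D.map g).basisC x,
    ← gradedVolCoord_smul_gradedVol n (D.map g).basisA y, TensorProduct.smul_tmul_smul]
  simp [hvol, detIso_gradedVol]

theorem ranks_eq (D D' : L.AdaptedBases) : D.p = D'.p ∧ D.q = D'.q ∧ D.r = D'.r := by
  have hA i : prev D.r i + D.p i = prev D'.r i + D'.p i :=
    Fin.equiv_iff_eq.1 ⟨(D.basisA i).indexEquiv (D'.basisA i)⟩
  have hB i : D.p i + D.q i = D'.p i + D'.q i :=
    Fin.equiv_iff_eq.1 ⟨(D.basisB i).indexEquiv (D'.basisB i)⟩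
  have hC i : D.q i + D.r i = D'.q i + D'.r i :=
    Fin.equiv_iff_eq.1 ⟨(D.basisC i).indexEquiv (D'.basisC i)⟩
  have hr i : prev D.r i = prev D'.r i := by
    induction i with
    | zero => rfl
    | succ i ih => grind [prev]
  simp only [funext_iff]
  grind

theorem a_basisA_castAdd (D : L.AdaptedBases) (i : ℕ) (j : Fin (prev D.r i)) :
    L.a i (D.basisA i (Fin.castAdd (D.p i) j)) = 0 := by
  cases i with
  | zero => exact j.elim0
  | succ i => exact (congrArg _ (D.map_δ i j)).trans ((L.exact_δ_a i).apply_apply_eq_zero _)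

theorem b_basisB_castAdd (D : L.AdaptedBases) (i : ℕ) (j : Fin (D.p i)) :
    L.b i (D.basisB i (Fin.castAdd (D.q i) j)) = 0 := by
  rw [D.map_a, (L.exact_a_b i).apply_apply_eq_zero]

theorem δ_basisC_castAdd (D : L.AdaptedBases) (i : ℕ) (j : Fin (D.q i)) :
    L.δ i (D.basisC i (Fin.castAdd (D.r i) j)) = 0 := by
  rw [D.map_b, (L.exact_b_δ i).apply_apply_eq_zero]

theorem exists_eq_map (D D' : L.AdaptedBases) : ∃ g : L.Automorphism, D' = D.map g := by
  obtain ⟨hp, hq, hr⟩ := D.ranks_eq D'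
  have hA := And.intro D.a_basisA_castAdd D'.a_basisA_castAdd
  have hB := And.intro D.b_basisB_castAdd D'.b_basisB_castAdd
  have hC := And.intro D.δ_basisC_castAdd D'.δ_basisC_castAdd
  obtain ⟨p, q, r, bA, bB, bC, ha, hb, hδ⟩ := D
  obtain ⟨p', q', r', bA', bB', bC', ha', hb', hδ'⟩ := D'
  dsimp only at hp hq hr hA hB hC
  subst hp hq hr
  let eA i := (bA i).equiv (bA' i) (Equiv.refl _)
  let eB i := (bB i).equiv (bB' i) (Equiv.refl _)
  let eC i := (bC i).equiv (bC' i) (Equiv.refl _)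
  have comm_a i : L.a i ∘ₗ (eA i).toLinearMap = (eB i).toLinearMap ∘ₗ L.a i :=
    (bA i).ext fun j => by induction j using Fin.addCases <;> simp [eA, eB, hA, ← ha, ← ha']
  have comm_b i : L.b i ∘ₗ (eB i).toLinearMap = (eC i).toLinearMap ∘ₗ L.b i :=
    (bB i).ext fun j => by induction j using Fin.addCases <;> simp [eB, eC, hB, ← hb, ← hb']
  have comm_δ i : L.δ i ∘ₗ (eC i).toLinearMap = (eA (i + 1)).toLinearMap ∘ₗ L.δ i :=
    (bC i).ext fun j => by induction j using Fin.addCases <;> simp [eC, eA, hC, ← hδ, ← hδ']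
  exact ⟨⟨eA, eB, eC, fun i => LinearMap.congr_fun (comm_a i),
    fun i => LinearMap.congr_fun (comm_b i), fun i => LinearMap.congr_fun (comm_δ i)⟩,
    by simp [map, eA, eB, eC, Module.Basis.map_equiv]⟩

end AdaptedBases

theorem detMap_eq_detIso {n : ℕ} (hL : L.IsFinite n) (D : L.AdaptedBases) :
    L.detMap n = (D.detIso n).toLinearMap := by
  obtain ⟨g, hg⟩ := D.exists_eq_map (nonempty_adaptedBases hL).some
  rw [detMap, dif_pos hL, hg, D.detIso_map g hL]

/-- The types `P i`, `Q i` and `R i` index the vectors of `A i`, `B i` and `C (i - 1)` that are not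
in the image of the preceding map. -/
theorem eqUpToSign_detMap {n : ℕ} (hL : L.IsFinite n)
    {κA κB κC P Q R : ℕ → Type*} [∀ i, Fintype (κA i)] [∀ i, Fintype (κB i)] [∀ i, Fintype (κC i)]
    [∀ i, Finite (P i)] [∀ i, Finite (Q i)] [∀ i, Finite (R i)] [IsEmpty (R 0)]
    {bA : ∀ i, Module.Basis (κA i) ℂ (L.A i)} {bB : ∀ i, Module.Basis (κB i) ℂ (L.B i)}
    {bC : ∀ i, Module.Basis (κC i) ℂ (L.C i)} (eA : ∀ i, R i ⊕ P i ≃ κA i)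
    (eB : ∀ i, P i ⊕ Q i ≃ κB i) (eC : ∀ i, Q i ⊕ R (i + 1) ≃ κC i)
    (ha : ∀ i j, bB i (eB i (.inl j)) = L.a i (bA i (eA i (.inr j))))
    (hb : ∀ i j, bC i (eC i (.inl j)) = L.b i (bB i (eB i (.inr j))))
    (hδ : ∀ i j, bA (i + 1) (eA (i + 1) (.inl j)) = L.δ i (bC i (eC i (.inr j)))) :
    EqUpToSign (L.detMap n (enumVol n bC ⊗ₜ enumVol n bA)) (enumVol n bB) := by
  let fP i := Finite.equivFin (P i)
  let fQ i := Finite.equivFin (Q i)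
  let fR i := Finite.equivFin (R (i + 1))
  let fR' : ∀ i, R i ≃ Fin (prev (fun i => Nat.card (R (i + 1))) i)
    | 0 => Equiv.equivOfIsEmpty _ (Fin 0)
    | i + 1 => fR i
  let gA i := (eA i).symm.trans (((fR' i).sumCongr (fP i)).trans finSumFinEquiv)
  let gB i := (eB i).symm.trans (((fP i).sumCongr (fQ i)).trans finSumFinEquiv)
  let gC i := (eC i).symm.trans (((fQ i).sumCongr (fR i)).trans finSumFinEquiv)
  have gA_castAdd (i j) : (gA (i + 1)).symm (Fin.castAdd _ j) = eA (i + 1) (.inl ((fR i).symm j)) :=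
    congrArg (eA (i + 1) ∘ Sum.map _ _) (finSumFinEquiv_symm_apply_castAdd j)
  let D : L.AdaptedBases :=
    { p := fun i => Nat.card (P i)
      q := fun i => Nat.card (Q i)
      r := fun i => Nat.card (R (i + 1))
      basisA := fun i => (bA i).reindex (gA i)
      basisB := fun i => (bB i).reindex (gB i)
      basisC := fun i => (bC i).reindex (gC i)
      map_a := fun i j => by simp [gA, gB, ha]
      map_b := fun i j => by simp [gB, gC, hb]
      map_δ := fun i j => by
        simpa [gC, ← hδ] using congrArg (bA (i + 1)) (gA_castAdd i j) }
  have hD := ((eqUpToSign_gradedVol_enumVol n bC gC).symm.tmul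
    (eqUpToSign_gradedVol_enumVol n bA gA).symm).map (D.detIso n)
  rw [detMap_eq_detIso hL D]
  refine hD.trans ?_
  exact (D.detIso_gradedVol n).symm ▸ eqUpToSign_gradedVol_enumVol n bB gB

end LongExactSequence

theorem IsBasisOf.exists_lift {K V W : Type*} [DivisionRing K] [AddCommGroup V] [Module K V]
    [AddCommGroup W] [Module K W] [FiniteDimensional K W] (f : V →ₗ[K] W) {M : Submodule K V}
    {N : Submodule K W} (hN : N ≤ M.map f) :
    ∃ (m : ℕ) (v : Fin m → V), (∀ j, v j ∈ M) ∧ IsBasisOf (fun j => f (v j)) N := by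
  let b := Module.finBasis K N
  choose v hvM hv using fun j => hN (b j).2
  refine ⟨_, v, hvM, ?_⟩
  rw [funext hv]
  refine ⟨b.linearIndependent.map' N.subtype N.ker_subtype, ?_⟩
  change Submodule.span K (range (N.subtype ∘ b)) = N
  rw [range_comp, Submodule.span_image, b.span_eq, Submodule.map_top, N.range_subtype]

section IsLongExact

variable {A B C : ℕ → ModuleCat.{u} ℂ} (a : ∀ i, A i →ₗ[ℂ] B i) (b : ∀ i, B i →ₗ[ℂ] C i)
  (δ : ∀ i, C i →ₗ[ℂ] A (i + 1))

/-- The maps `a`, `b` and `δ` form a long exact sequence `0 → A 0 → B 0 → C 0 → A 1 → ⋯`: the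
unbundled form of `LongExactSequence`, for several sequences that share terms and maps. -/
structure IsLongExact : Prop where
  injective : Function.Injective (a 0)
  exact_left : ∀ i, Function.Exact (a i) (b i)
  exact_middle : ∀ i, Function.Exact (b i) (δ i)
  exact_right : ∀ i, Function.Exact (δ i) (a (i + 1))

variable {a b δ}

/-- The bundled form of a long exact sequence. -/
abbrev IsLongExact.toLongExactSequence (h : IsLongExact a b δ) : LongExactSequence.{u} :=
  ⟨A, B, C, a, b, δ, h.injective, h.exact_left, h.exact_middle, h.exact_right⟩

end IsLongExact

/-- A braid of four long exact sequences `a → b → c`, `a → d → e`, `b → d → f` and `c → e → f`: the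
cohomologies of the pairs in a quadruple of spaces. A map is named after its source and target, and
`ca`, `ea`, `fb`, `fc` are the connecting maps. -/
structure ExactBraid where
  (a b c d e f : ℕ → ModuleCat.{u} ℂ)
  ab : ∀ i, a i →ₗ[ℂ] b i
  bc : ∀ i, b i →ₗ[ℂ] c i
  ca : ∀ i, c i →ₗ[ℂ] a (i + 1)
  ad : ∀ i, a i →ₗ[ℂ] d i
  de : ∀ i, d i →ₗ[ℂ] e i
  ea : ∀ i, e i →ₗ[ℂ] a (i + 1)
  bd : ∀ i, b i →ₗ[ℂ] d i
  df : ∀ i, d i →ₗ[ℂ] f i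
  fb : ∀ i, f i →ₗ[ℂ] b (i + 1)
  ce : ∀ i, c i →ₗ[ℂ] e i
  ef : ∀ i, e i →ₗ[ℂ] f i
  fc : ∀ i, f i →ₗ[ℂ] c (i + 1)
  abc : IsLongExact ab bc ca
  ade : IsLongExact ad de ea
  bdf : IsLongExact bd df fb
  cef : IsLongExact ce ef fc
  bd_ab : ∀ i x, bd i (ab i x) = ad i x
  de_bd : ∀ i x, de i (bd i x) = ce i (bc i x)
  ef_de : ∀ i x, ef i (de i x) = df i x
  ea_ce : ∀ i x, ea i (ce i x) = ca i x
  fb_ef : ∀ i x, fb i (ef i x) = ab (i + 1) (ea i x)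
  bc_fb : ∀ i x, bc (i + 1) (fb i x) = fc i x

namespace ExactBraid

variable (S : ExactBraid.{u})

theorem range_de_comp_bd (i : ℕ) :
    (S.de i ∘ₗ S.bd i).range = (S.ef i).ker ⊓ (S.ea i).ker := by
  refine le_antisymm ?_ fun y ⟨hef, hea⟩ => ?_
  · rintro _ ⟨x, rfl⟩
    exact ⟨(S.ef_de i _).trans ((S.bdf.exact_left i).apply_apply_eq_zero x),
      (S.ade.exact_middle i).apply_apply_eq_zero _⟩
  · obtain ⟨x, rfl⟩ := (S.ade.exact_middle i y).1 hea
    obtain ⟨z, rfl⟩ := (S.bdf.exact_left i x).1 ((S.ef_de i x).symm.trans hef)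
    exact ⟨z, rfl⟩

theorem range_fb_comp_ef (i : ℕ) :
    (S.fb i ∘ₗ S.ef i).range = (S.bd (i + 1)).ker ⊓ (S.bc (i + 1)).ker := by
  refine le_antisymm ?_ fun y ⟨hbd, hbc⟩ => ?_
  · rintro _ ⟨x, rfl⟩
    exact ⟨(S.bdf.exact_right i).apply_apply_eq_zero _,
      (S.bc_fb i _).trans ((S.cef.exact_middle i).apply_apply_eq_zero x)⟩
  · obtain ⟨x, rfl⟩ := (S.bdf.exact_right i y).1 hbd
    obtain ⟨z, rfl⟩ := (S.cef.exact_middle i x).1 ((S.bc_fb i x).symm.trans hbc)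
    exact ⟨z, rfl⟩

theorem ker_ce_le_map_ker_bd (i : ℕ) : (S.ce i).ker ≤ (S.bd i).ker.map (S.bc i) := by
  intro x hx
  obtain ⟨y, rfl⟩ := (S.abc.exact_middle i x).1 (by rw [← S.ea_ce, hx, map_zero])
  obtain ⟨z, hz⟩ := (S.ade.exact_left i (S.bd i y)).1 ((S.de_bd i y).trans hx)
  refine ⟨y - S.ab i z, ?_, ?_⟩
  · rw [SetLike.mem_coe, LinearMap.mem_ker, map_sub, S.bd_ab, hz, sub_self]
  · rw [map_sub, (S.abc.exact_left i).apply_apply_eq_zero, sub_zero]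

/-- Families of vectors that decompose an exact braid into elementary ones. Each vector of the six
families `α`, `γ`, `ζ`, `ψ`, `φ`, `ρ` lives at the first spot of the braid where it is nonzero, and
the conditions `basis_*` concern its image at the last such spot. The primed families are the images
of `ψ`, `φ`, `ρ` under the connecting maps; they are indexed by the degree of the target. -/
structure Decomposition where
  (nα nγ nζ nψ nφ nρ : ℕ → ℕ)
  α : ∀ i, Fin (nα i) → S.a i
  γ : ∀ i, Fin (nγ i) → S.b i
  ζ : ∀ i, Fin (nζ i) → S.d i
  ψ : ∀ i, Fin (nψ (i + 1)) → S.c i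
  φ : ∀ i, Fin (nφ (i + 1)) → S.e i
  ρ : ∀ i, Fin (nρ (i + 1)) → S.f i
  ψ' : ∀ i, Fin (nψ i) → S.a i
  φ' : ∀ i, Fin (nφ i) → S.a i
  ρ' : ∀ i, Fin (nρ i) → S.b i
  ca_ψ : ∀ i j, S.ca i (ψ i j) = ψ' (i + 1) j
  ea_φ : ∀ i j, S.ea i (φ i j) = φ' (i + 1) j
  fb_ρ : ∀ i j, S.fb i (ρ i j) = ρ' (i + 1) j
  bd_ρ' : ∀ i j, S.bd i (ρ' i j) = 0
  basis_α : ∀ i, IsBasisOf (fun j => S.ad i (α i j)) (S.de i).ker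
  basis_γ : ∀ i, IsBasisOf (fun j => S.de i (S.bd i (γ i j))) ((S.ef i).ker ⊓ (S.ea i).ker)
  basis_ζ : ∀ i, IsBasisOf (fun j => S.df i (ζ i j)) (S.fb i).ker
  basis_ψ' : ∀ i, IsBasisOf (ψ' i) (S.ab i).ker
  basis_φ' : ∀ i, IsBasisOf (fun j => S.ab i (φ' i j)) ((S.bd i).ker ⊓ (S.bc i).ker)
  basis_ρ' : ∀ i, IsBasisOf (fun j => S.bc i (ρ' i j)) (S.ce i).ker

theorem nonempty_decomposition [∀ i, FiniteDimensional ℂ (S.a i)]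
    [∀ i, FiniteDimensional ℂ (S.b i)] [∀ i, FiniteDimensional ℂ (S.c i)]
    [∀ i, FiniteDimensional ℂ (S.d i)] [∀ i, FiniteDimensional ℂ (S.e i)]
    [∀ i, FiniteDimensional ℂ (S.f i)] : Nonempty S.Decomposition := by
  choose nα α _ basis_α using fun i => IsBasisOf.exists_lift (S.ad i) (M := ⊤)
    (N := (S.de i).ker) (by rw [Submodule.map_top, (S.ade.exact_left i).linearMap_ker_eq])
  choose nγ γ _ basis_γ using fun i => IsBasisOf.exists_lift (S.de i ∘ₗ S.bd i) (M := ⊤)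
    (N := (S.ef i).ker ⊓ (S.ea i).ker) (by rw [Submodule.map_top, S.range_de_comp_bd])
  choose nζ ζ _ basis_ζ using fun i => IsBasisOf.exists_lift (S.df i) (M := ⊤)
    (N := (S.fb i).ker) (by rw [Submodule.map_top, (S.bdf.exact_middle i).linearMap_ker_eq])
  choose nψ ψ' _ basis_ψ' using fun i => IsBasisOf.exists_lift LinearMap.id (M := ⊤)
    (N := (S.ab i).ker) (by rw [Submodule.map_id]; exact le_top)
  choose nφ φ' _ basis_φ' using fun i => IsBasisOf.exists_lift (S.ab i) (M := ⊤)
    (N := (S.bd i).ker ⊓ (S.bc i).ker)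
    (by rw [Submodule.map_top, ← (S.abc.exact_left i).linearMap_ker_eq]; exact inf_le_right)
  choose nρ ρ' bd_ρ' basis_ρ' using fun i =>
    IsBasisOf.exists_lift (S.bc i) (S.ker_ce_le_map_ker_bd i)
  choose ψ ca_ψ using fun i j =>
    (S.abc.exact_right i _).1 (LinearMap.mem_ker.1 ((basis_ψ' (i + 1)).mem j))
  choose φ ea_φ using fun i j => (S.ade.exact_right i (φ' (i + 1) j)).1
    ((S.bd_ab _ _).symm.trans (LinearMap.mem_ker.1 ((basis_φ' (i + 1)).mem j).1))
  choose ρ fb_ρ using fun i j =>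
    (S.bdf.exact_right i (ρ' (i + 1) j)).1 (LinearMap.mem_ker.1 (bd_ρ' (i + 1) j))
  exact ⟨{
    nα, nγ, nζ, nψ, nφ, nρ, α, γ, ζ, ψ, φ, ρ, ψ', φ', ρ', ca_ψ, ea_φ, fb_ρ, bd_ρ', basis_α, basis_γ,
    basis_ζ, basis_ψ', basis_φ', basis_ρ' }⟩

namespace Decomposition

variable {S} (D : S.Decomposition)

theorem isEmpty_ψ : IsEmpty (Fin (D.nψ 0)) :=
  (LinearMap.ker_eq_bot.2 S.abc.injective ▸ D.basis_ψ' 0).isEmpty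

theorem isEmpty_φ : IsEmpty (Fin (D.nφ 0)) := by
  have h := D.basis_φ' 0
  rw [LinearMap.ker_eq_bot.2 S.bdf.injective, bot_inf_eq] at h
  exact h.isEmpty

theorem isEmpty_ρ : IsEmpty (Fin (D.nρ 0)) :=
  (LinearMap.ker_eq_bot.2 S.cef.injective ▸ D.basis_ρ' 0).isEmpty

/-- The basis of `a` formed by the families of a decomposition. -/
noncomputable def basisA (i : ℕ) :
    Module.Basis ((Fin (D.nψ i) ⊕ Fin (D.nφ i)) ⊕ Fin (D.nα i)) ℂ (S.a i) :=
  (IsBasisOf.of_comp (S.bd_ab i) (S.abc.exact_left i) (S.ade.exact_left i) (D.basis_ψ' i)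
    (D.basis_φ' i) (D.basis_α i)).basis

/-- The basis of `b` formed by the families of a decomposition. -/
noncomputable def basisB (i : ℕ) :
    Module.Basis (((Fin (D.nφ i) ⊕ Fin (D.nα i)) ⊕ Fin (D.nρ i)) ⊕ Fin (D.nγ i)) ℂ (S.b i) :=
  (IsBasisOf.of_square (S.de_bd i) (D.basis_φ' i)
    (fun _ => (S.abc.exact_left i).apply_apply_eq_zero _)
    (by simpa only [S.bd_ab] using D.basis_α i) (D.bd_ρ' i) (D.basis_ρ' i)
    (by rw [S.range_de_comp_bd]; exact D.basis_γ i)).basis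

/-- The basis of `c` formed by the families of a decomposition. -/
noncomputable def basisC (i : ℕ) :
    Module.Basis ((Fin (D.nρ i) ⊕ Fin (D.nγ i)) ⊕ Fin (D.nψ (i + 1))) ℂ (S.c i) :=
  (IsBasisOf.of_comp (v := fun j => S.bc i (D.γ i j)) (w := D.ψ i) (S.ea_ce i)
    (S.cef.exact_left i) (S.abc.exact_right i) (D.basis_ρ' i)
    (by simpa only [S.de_bd, inf_comm] using D.basis_γ i)
    (by simpa only [D.ca_ψ] using D.basis_ψ' (i + 1))).basis

/-- The basis of `d` formed by the families of a decomposition. -/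
noncomputable def basisD (i : ℕ) :
    Module.Basis ((Fin (D.nα i) ⊕ Fin (D.nγ i)) ⊕ Fin (D.nζ i)) ℂ (S.d i) :=
  (IsBasisOf.of_comp (S.ef_de i) (S.ade.exact_middle i) (S.bdf.exact_middle i) (D.basis_α i)
    (D.basis_γ i) (D.basis_ζ i)).basis

/-- The basis of `e` formed by the families of a decomposition. -/
noncomputable def basisE (i : ℕ) :
    Module.Basis (((Fin (D.nγ i) ⊕ Fin (D.nζ i)) ⊕ Fin (D.nψ (i + 1))) ⊕ Fin (D.nφ (i + 1))) ℂ
      (S.e i) :=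
  (IsBasisOf.of_square (v := fun j => S.de i (D.ζ i j)) (w := fun j => S.ce i (D.ψ i j))
    (x := D.φ i) (S.fb_ef i) (D.basis_γ i)
    (fun _ => (S.ade.exact_middle i).apply_apply_eq_zero _)
    (by simpa only [S.ef_de] using D.basis_ζ i)
    (fun _ => (S.cef.exact_left i).apply_apply_eq_zero _)
    (by simpa only [S.ea_ce, D.ca_ψ] using D.basis_ψ' (i + 1))
    (by simpa only [S.range_fb_comp_ef, S.fb_ef, D.ea_φ] using D.basis_φ' (i + 1))).basis

/-- The basis of `f` formed by the families of a decomposition. -/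
noncomputable def basisF (i : ℕ) :
    Module.Basis ((Fin (D.nζ i) ⊕ Fin (D.nφ (i + 1))) ⊕ Fin (D.nρ (i + 1))) ℂ (S.f i) :=
  (IsBasisOf.of_comp (v := fun j => S.ef i (D.φ i j)) (w := D.ρ i) (S.bc_fb i)
    (S.bdf.exact_right i) (S.cef.exact_right i) (D.basis_ζ i)
    (by simpa only [S.fb_ef, D.ea_φ, inf_comm] using D.basis_φ' (i + 1))
    (by simpa only [← S.bc_fb, D.fb_ρ] using D.basis_ρ' (i + 1))).basis

theorem eqUpToSign_detMap_abc {n : ℕ} (hS : S.abc.toLongExactSequence.IsFinite n) :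
    EqUpToSign (S.abc.toLongExactSequence.detMap n (enumVol n D.basisC ⊗ₜ enumVol n D.basisA))
      (enumVol n D.basisB) := by
  have := D.isEmpty_ψ
  refine LongExactSequence.eqUpToSign_detMap hS (R := fun i => Fin (D.nψ i))
    (fun _ => (Equiv.sumAssoc _ _ _).symm) (fun _ => (Equiv.sumAssoc _ _ _).symm)
    (fun _ => Equiv.refl _) ?_ ?_ ?_
  · rintro i (j | j) <;> simp [basisA, basisB]
  · rintro i (j | j) <;> simp [basisB, basisC]
  · intro i j
    simp [basisA, basisC, D.ca_ψ]

theorem eqUpToSign_detMap_ade {n : ℕ} (hS : S.ade.toLongExactSequence.IsFinite n) :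
    EqUpToSign (S.ade.toLongExactSequence.detMap n (enumVol n D.basisE ⊗ₜ enumVol n D.basisA))
      (enumVol n D.basisD) := by
  have := D.isEmpty_ψ
  have := D.isEmpty_φ
  refine LongExactSequence.eqUpToSign_detMap hS (R := fun i => Fin (D.nψ i) ⊕ Fin (D.nφ i))
    (fun _ => Equiv.refl _) (fun _ => (Equiv.sumAssoc _ _ _).symm)
    (fun _ => (Equiv.sumAssoc _ _ _).symm) ?_ ?_ ?_
  · intro i j
    simp [basisA, basisD]
  · rintro i (j | j) <;> simp [basisD, basisE]
  · rintro i (j | j) <;> simp [basisA, basisE, S.ea_ce, D.ca_ψ, D.ea_φ]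

theorem eqUpToSign_detMap_bdf {n : ℕ} (hS : S.bdf.toLongExactSequence.IsFinite n) :
    EqUpToSign (S.bdf.toLongExactSequence.detMap n (enumVol n D.basisF ⊗ₜ enumVol n D.basisB))
      (enumVol n D.basisD) := by
  have := D.isEmpty_φ
  have := D.isEmpty_ρ
  refine LongExactSequence.eqUpToSign_detMap hS (R := fun i => Fin (D.nφ i) ⊕ Fin (D.nρ i))
    (fun _ => (Equiv.sumSumSumComm _ _ _ _).trans (Equiv.sumAssoc _ _ _).symm)
    (fun _ => Equiv.refl _) (fun _ => (Equiv.sumAssoc _ _ _).symm) ?_ ?_ ?_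
  · rintro i (j | j) <;> simp [basisB, basisD, S.bd_ab]
  · intro i j
    simp [basisD, basisF]
  · rintro i (j | j) <;> simp [basisB, basisF, S.fb_ef, D.ea_φ, D.fb_ρ]

theorem eqUpToSign_detMap_cef {n : ℕ} (hS : S.cef.toLongExactSequence.IsFinite n) :
    EqUpToSign (S.cef.toLongExactSequence.detMap n (enumVol n D.basisF ⊗ₜ enumVol n D.basisC))
      (enumVol n D.basisE) := by
  have := D.isEmpty_ρ
  refine LongExactSequence.eqUpToSign_detMap hS (R := fun i => Fin (D.nρ i))
    (fun _ => (Equiv.sumAssoc _ _ _).symm)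
    (fun _ => (Equiv.sumSumSumComm _ _ _ _).trans (Equiv.sumAssoc _ _ _).symm)
    (fun _ => Equiv.refl _) ?_ ?_ ?_
  · rintro i (j | j) <;> simp [basisC, basisE, S.de_bd]
  · rintro i (j | j) <;> simp [basisE, basisF, S.ef_de]
  · intro i j
    simp [basisC, basisF, ← S.bc_fb, D.fb_ρ]

end Decomposition

end ExactBraid

section Lines

variable {R A B C D E F : Type*} [CommRing R] [AddCommGroup A] [Module R A] [AddCommGroup B]
  [Module R B] [AddCommGroup C] [Module R C] [AddCommGroup D] [Module R D] [AddCommGroup E]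
  [Module R E] [AddCommGroup F] [Module R F]

theorem eqUpToSign_comp_rTensor_comp_lTensor {a : A} {b : B} {c : C} {d : D} {e : E} {f : F}
    (ha : ∀ x, ∃ t : R, t • a = x) (hc : ∀ x, ∃ t : R, t • c = x) (hf : ∀ x, ∃ t : R, t • f = x)
    {p : E ⊗[R] A →ₗ[R] D} {q : F ⊗[R] C →ₗ[R] E} {r : F ⊗[R] B →ₗ[R] D} {s : C ⊗[R] A →ₗ[R] B}
    (hp : EqUpToSign (p (e ⊗ₜ a)) d) (hq : EqUpToSign (q (f ⊗ₜ c)) e)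
    (hr : EqUpToSign (r (f ⊗ₜ b)) d) (hs : EqUpToSign (s (c ⊗ₜ a)) b) :
    EqUpToSign (p.comp (q.rTensor A))
      (r.comp ((s.lTensor F).comp (TensorProduct.assoc R F C A).toLinearMap)) := by
  have hpq : EqUpToSign (p (q (f ⊗ₜ c) ⊗ₜ a)) d :=
    (hq.map (p ∘ₗ (TensorProduct.mk R E A).flip a)).trans hp
  have hrs : EqUpToSign (r (f ⊗ₜ s (c ⊗ₜ a))) d :=
    (hs.map (r ∘ₗ TensorProduct.mk R F B f)).trans hr
  obtain ⟨ε, hε⟩ := hpq.trans hrs.symm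
  refine ⟨ε, TensorProduct.ext_threefold fun x y z => ?_⟩
  obtain ⟨t₁, rfl⟩ := hf x
  obtain ⟨t₂, rfl⟩ := hc y
  obtain ⟨t₃, rfl⟩ := ha z
  simp only [LinearMap.comp_apply, LinearMap.smul_apply, LinearEquiv.coe_coe,
    LinearMap.rTensor_tmul, LinearMap.lTensor_tmul, TensorProduct.assoc_tmul,
    ← TensorProduct.smul_tmul', TensorProduct.tmul_smul, map_smul, hε]

end Lines

/-- The graded vector space `E` is finite-dimensional in each degree and vanishes in degrees
`> n`. -/
structure IsFiniteGraded (n : ℕ) (E : ℕ → ModuleCat.{u} ℂ) : Prop where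
  finite : ∀ i, FiniteDimensional ℂ (E i)
  zero : ∀ i, n < i → Subsingleton (E i)

namespace LongExactSequence

variable {L : LongExactSequence.{u}} {n : ℕ}

theorem isFiniteGraded_B (hA : IsFiniteGraded n L.A) (hC : IsFiniteGraded n L.C) :
    IsFiniteGraded n L.B where
  finite i := by
    have := hA.finite i
    have := hC.finite i
    have := isNoetherian_of_range_eq_ker (L.a i) (L.b i) (L.exact_a_b i).linearMap_ker_eq.symm
    infer_instance
  zero i hi := by
    have := hA.zero i hi
    have := hC.zero i hi
    refine subsingleton_of_forall_eq 0 fun x => ?_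
    obtain ⟨y, rfl⟩ := (L.exact_a_b i x).1 (Subsingleton.elim _ _)
    rw [Subsingleton.elim y 0, map_zero]

theorem isFinite_iff : L.IsFinite n ↔ IsFiniteGraded n L.A ∧ IsFiniteGraded n L.C := by
  refine ⟨fun h => ⟨⟨h.finA, h.zeroA⟩, h.finC, h.zeroC⟩, fun ⟨hA, hC⟩ => ?_⟩
  have hB := isFiniteGraded_B hA hC
  exact ⟨hA.finite, hB.finite, hC.finite, hA.zero, hB.zero, hC.zero⟩

theorem detMap_eq_zero (h : ¬ L.IsFinite n) : L.detMap n = 0 :=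
  dif_neg h

end LongExactSequence

namespace ExactBraid

variable (S : ExactBraid.{u}) (n : ℕ)

theorem isFinite_ade_and_cef_iff :
    S.ade.toLongExactSequence.IsFinite n ∧ S.cef.toLongExactSequence.IsFinite n ↔
      S.bdf.toLongExactSequence.IsFinite n ∧ S.abc.toLongExactSequence.IsFinite n := by
  simp only [LongExactSequence.isFinite_iff]
  refine ⟨fun ⟨⟨ha, _⟩, hc, hf⟩ => ⟨⟨?_, hf⟩, ha, hc⟩, fun ⟨⟨_, hf⟩, ha, hc⟩ => ⟨⟨ha, ?_⟩, hc, hf⟩⟩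
  · exact S.abc.toLongExactSequence.isFiniteGraded_B ha hc
  · exact S.cef.toLongExactSequence.isFiniteGraded_B hc hf

theorem eqUpToSign_detMap_comp :
    EqUpToSign
      ((S.ade.toLongExactSequence.detMap n).comp
        ((S.cef.toLongExactSequence.detMap n).rTensor (GradedDet n S.a)))
      ((S.bdf.toLongExactSequence.detMap n).comp
        (((S.abc.toLongExactSequence.detMap n).lTensor (GradedDet n S.f)).comp
          (TensorProduct.assoc ℂ (GradedDet n S.f) (GradedDet n S.c)
            (GradedDet n S.a)).toLinearMap)) := by
  by_cases h : S.ade.toLongExactSequence.IsFinite n ∧ S.cef.toLongExactSequence.IsFinite n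
  · obtain ⟨hade, hcef⟩ := h
    obtain ⟨hbdf, habc⟩ := (S.isFinite_ade_and_cef_iff n).1 ⟨hade, hcef⟩
    have := habc.finA
    have := habc.finB
    have := habc.finC
    have := hade.finB
    have := hade.finC
    have := hcef.finC
    obtain ⟨D⟩ := S.nonempty_decomposition
    exact eqUpToSign_comp_rTensor_comp_lTensor (enumVol_generates n D.basisA)
      (enumVol_generates n D.basisC) (enumVol_generates n D.basisF) (D.eqUpToSign_detMap_ade hade)
      (D.eqUpToSign_detMap_cef hcef) (D.eqUpToSign_detMap_bdf hbdf) (D.eqUpToSign_detMap_abc habc)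
  · -- `detMap` is `0` by convention on sequences that are not finite, so both composites vanish.
    have h' := (S.isFinite_ade_and_cef_iff n).not.1 h
    refine ⟨1, Eq.trans (b := 0) ?_ (Eq.symm ?_)⟩
    · rcases not_and_or.1 h with h | h <;> simp [LongExactSequence.detMap_eq_zero h]
    · rcases not_and_or.1 h' with h | h <;> simp [LongExactSequence.detMap_eq_zero h]

end ExactBraid

section Homology

variable {R ι : Type*} [Ring R] {c : ComplexShape ι}

theorem homologyMap_comp_apply {K L M : HomologicalComplex (ModuleCat R) c} {f : K ⟶ L} {g : L ⟶ M}
    {h : K ⟶ M} (e : f ≫ g = h) (i : ι) (x : K.homology i) :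
    (HomologicalComplex.homologyMap g i).hom ((HomologicalComplex.homologyMap f i).hom x) =
      (HomologicalComplex.homologyMap h i).hom x := by
  subst e
  rw [HomologicalComplex.homologyMap_comp]
  rfl

theorem homologyMap_id_apply (K : HomologicalComplex (ModuleCat R) c) (i : ι) (x : K.homology i) :
    (HomologicalComplex.homologyMap (𝟙 K) i).hom x = x := by
  rw [HomologicalComplex.homologyMap_id]
  rfl

theorem δ_naturality_apply {S T : ShortComplex (HomologicalComplex (ModuleCat R) c)} (φ : S ⟶ T)
    (hS : S.ShortExact) (hT : T.ShortExact) {i j : ι} (hij : c.Rel i j) (x : S.X₃.homology i) :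
    (HomologicalComplex.homologyMap φ.τ₁ j).hom ((hS.δ i j hij).hom x) =
      (hT.δ i j hij).hom ((HomologicalComplex.homologyMap φ.τ₃ i).hom x) :=
  LinearMap.congr_fun (congrArg ModuleCat.Hom.hom
    (HomologicalComplex.HomologySequence.δ_naturality φ hS hT i j hij)) x

end Homology

namespace FlatVectorBundle

variable {X : Type u} [TopologicalSpace X] {r : ℕ} {ι : Type*} (F : FlatVectorBundle X r ι)

theorem complexIncl_comp (R : Set X) {P Q Q' : Set X} (h : P ⊆ Q) (h' : Q ⊆ Q') :
    F.complexIncl R h' ≫ F.complexIncl R h = F.complexIncl R (h.trans h') := by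
  ext k : 2
  rfl

theorem complexRestr_comp {R Q Q' : Set X} (h : Q ⊆ Q') (h' : Q' ⊆ R) (P : Set X) :
    F.complexRestr h' P ≫ F.complexRestr h P = F.complexRestr (h.trans h') P := by
  ext k : 2
  rfl

theorem complexIncl_complexRestr {P P' Q R : Set X} (h : P ⊆ P') (h' : Q ⊆ R) :
    F.complexIncl R h ≫ F.complexRestr h' P = F.complexRestr h' P' ≫ F.complexIncl Q h := by
  ext k : 2
  rfl

/-- The map of short exact sequences of triples given by enlarging the smallest space. -/
noncomputable def tripleSequenceIncl {P P' Q R : Set X} (h : P ⊆ P') (hPQ : P' ⊆ Q) (hQR : Q ⊆ R) :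
    F.tripleSequence hPQ hQR ⟶ F.tripleSequence (h.trans hPQ) hQR where
  τ₁ := 𝟙 _
  τ₂ := F.complexIncl R h
  τ₃ := F.complexIncl Q h
  comm₁₂ := (Category.id_comp _).trans (F.complexIncl_comp R h hPQ).symm
  comm₂₃ := F.complexIncl_complexRestr h hQR

/-- The map of short exact sequences of triples given by enlarging the middle space. -/
noncomputable def tripleSequenceMid {P Q Q' R : Set X} (hPQ : P ⊆ Q) (h : Q ⊆ Q') (hQR : Q' ⊆ R) :
    F.tripleSequence (hPQ.trans h) hQR ⟶ F.tripleSequence hPQ (h.trans hQR) where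
  τ₁ := F.complexIncl R h
  τ₂ := 𝟙 _
  τ₃ := F.complexRestr h P
  comm₁₂ := (F.complexIncl_comp R hPQ h).trans (Category.comp_id _).symm
  comm₂₃ := (Category.id_comp _).trans (F.complexRestr_comp h hQR P).symm

/-- The map of short exact sequences of triples given by shrinking the largest space. -/
noncomputable def tripleSequenceRestr {P Q R R' : Set X} (hPQ : P ⊆ Q) (hQR : Q ⊆ R) (h : R ⊆ R') :
    F.tripleSequence hPQ (hQR.trans h) ⟶ F.tripleSequence hPQ hQR where
  τ₁ := F.complexRestr h Q
  τ₂ := F.complexRestr h P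
  τ₃ := 𝟙 _
  comm₁₂ := (F.complexIncl_complexRestr hPQ h).symm
  comm₂₃ := (F.complexRestr_comp hQR h P).trans (Category.comp_id _).symm

theorem isLongExact {P Q R : Set X} (hPQ : P ⊆ Q) (hQR : Q ⊆ R) :
    IsLongExact (F.longExactSequence hPQ hQR).a (F.longExactSequence hPQ hQR).b
      (F.longExactSequence hPQ hQR).δ where
  injective := (F.longExactSequence hPQ hQR).injective_a
  exact_left := (F.longExactSequence hPQ hQR).exact_a_b
  exact_middle := (F.longExactSequence hPQ hQR).exact_b_δ
  exact_right := (F.longExactSequence hPQ hQR).exact_δ_a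

/-- The braid formed by the long exact cohomology sequences of the four triples contained in a
filtration `P ⊆ Q ⊆ R ⊆ S`. -/
noncomputable def braid {P Q R S : Set X} (hPQ : P ⊆ Q) (hQR : Q ⊆ R) (hRS : R ⊆ S) :
    ExactBraid.{u} where
  a := F.cohomology S R
  b := F.cohomology S Q
  c := F.cohomology R Q
  d := F.cohomology S P
  e := F.cohomology R P
  f := F.cohomology Q P
  ab := (F.longExactSequence hQR hRS).a
  bc := (F.longExactSequence hQR hRS).b
  ca := (F.longExactSequence hQR hRS).δ
  ad := (F.longExactSequence (hPQ.trans hQR) hRS).a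
  de := (F.longExactSequence (hPQ.trans hQR) hRS).b
  ea := (F.longExactSequence (hPQ.trans hQR) hRS).δ
  bd := (F.longExactSequence hPQ (hQR.trans hRS)).a
  df := (F.longExactSequence hPQ (hQR.trans hRS)).b
  fb := (F.longExactSequence hPQ (hQR.trans hRS)).δ
  ce := (F.longExactSequence hPQ hQR).a
  ef := (F.longExactSequence hPQ hQR).b
  fc := (F.longExactSequence hPQ hQR).δ
  abc := F.isLongExact hQR hRS
  ade := F.isLongExact (hPQ.trans hQR) hRS
  bdf := F.isLongExact hPQ (hQR.trans hRS)
  cef := F.isLongExact hPQ hQR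
  bd_ab := homologyMap_comp_apply (F.complexIncl_comp S hPQ hQR)
  de_bd i x := (homologyMap_comp_apply (F.complexIncl_complexRestr hPQ hRS) i x).trans
    (homologyMap_comp_apply rfl i x).symm
  ef_de := homologyMap_comp_apply (F.complexRestr_comp hQR hRS P)
  ea_ce _ x := (δ_naturality_apply (F.tripleSequenceIncl hPQ hQR hRS)
    (F.tripleSequence_shortExact hQR hRS) (F.tripleSequence_shortExact (hPQ.trans hQR) hRS)
    rfl x).symm.trans (homologyMap_id_apply _ _ _)
  fb_ef _ x := (δ_naturality_apply (F.tripleSequenceMid hPQ hQR hRS)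
    (F.tripleSequence_shortExact (hPQ.trans hQR) hRS)
    (F.tripleSequence_shortExact hPQ (hQR.trans hRS)) rfl x).symm
  bc_fb _ x := (δ_naturality_apply (F.tripleSequenceRestr hPQ hQR hRS)
    (F.tripleSequence_shortExact hPQ (hQR.trans hRS)) (F.tripleSequence_shortExact hPQ hQR)
    rfl x).trans (congrArg _ (homologyMap_id_apply _ _ _))

end FlatVectorBundle

theorem proposition1p1_general {X : Type u} [TopologicalSpace X] {r : ℕ} {ι : Type*}
    (F : FlatVectorBundle X r ι) {P Q R S : Set X} (hPQ : P ⊆ Q) (hQR : Q ⊆ R) (hRS : R ⊆ S)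
    (n : ℕ) :
    EqUpToSign
      ((F.fusion n (hPQ.trans hQR) hRS).comp
        ((F.fusion n hPQ hQR).rTensor (GradedDet n (F.cohomology S R))))
      ((F.fusion n hPQ (hQR.trans hRS)).comp
        (((F.fusion n hQR hRS).lTensor (GradedDet n (F.cohomology Q P))).comp
          (TensorProduct.assoc ℂ (GradedDet n (F.cohomology Q P)) (GradedDet n (F.cohomology R Q))
            (GradedDet n (F.cohomology S R))).toLinearMap)) :=
  (F.braid hPQ hQR hRS).eqUpToSign_detMap_comp n

/-- `Y₃` is a compact smooth manifold with boundary, modelled on `I` (for instance `𝓡∂ m`, or `𝓡 0` in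
dimension zero); `Y₁` and `Y₂` are subsets of `Y₃` that are compact smooth manifolds with boundary of
the same dimension and whose inclusions in `Y₃` are smooth embeddings, with `Y₁ ⊆ int Y₂` and
`Y₂ ⊆ int Y₃`; `F` is a flat complex vector bundle of rank `r` on `Y₃`. With the canonical isomorphisms
`f_{1,21} : det H(Y₁) ⊗ det H(Y₂, Y₁) ≅ det H(Y₂)`,
`f_{2,32} : det H(Y₂) ⊗ det H(Y₃, Y₂) ≅ det H(Y₃)`,
`f_{1,31} : det H(Y₁) ⊗ det H(Y₃, Y₁) ≅ det H(Y₃)`,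
`f_{21,32} : det H(Y₂, Y₁) ⊗ det H(Y₃, Y₂) ≅ det H(Y₃, Y₁)`
of the triples of spaces, `f_{2,32} ∘ (f_{1,21} ⊗ id) = μ f_{1,31} ∘ (id ⊗ f_{21,32})` for some complex
number `μ` of modulus one. -/
theorem proposition1p1 {E : Type*} [NormedAddCommGroup E] [NormedSpace ℝ E] [FiniteDimensional ℝ E]
    {H : Type*} [TopologicalSpace H] (I : ModelWithCorners ℝ E H)
    {Y₃ : Type*} [TopologicalSpace Y₃] [T2Space Y₃] [CompactSpace Y₃]
    [ChartedSpace H Y₃] [IsManifold I ∞ Y₃]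
    (Y₁ Y₂ : Set Y₃) [CompactSpace Y₁] [CompactSpace Y₂]
    [ChartedSpace H Y₁] [IsManifold I ∞ Y₁] [ChartedSpace H Y₂] [IsManifold I ∞ Y₂]
    (_smooth₁ : ContMDiff I I ∞ (Subtype.val : Y₁ → Y₃))
    (_immersion₁ : ∀ y : Y₁, Function.Injective (mfderiv I I (Subtype.val : Y₁ → Y₃) y))
    (_smooth₂ : ContMDiff I I ∞ (Subtype.val : Y₂ → Y₃))
    (_immersion₂ : ∀ y : Y₂, Function.Injective (mfderiv I I (Subtype.val : Y₂ → Y₃) y))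
    (h₁₂ : Y₁ ⊆ Y₂)
    (_interior₁₂ : ∀ y (hy : y ∈ Y₁), (⟨y, h₁₂ hy⟩ : Y₂) ∈ I.interior Y₂)
    (_interior₂₃ : Y₂ ⊆ I.interior Y₃)
    {r : ℕ} {ι : Type*} (F : FlatVectorBundle Y₃ r ι) :
    ∃ μ : ℂ, ‖μ‖ = 1 ∧
      (F.fusion (Module.finrank ℝ E) (empty_subset Y₂) (subset_univ Y₂)).comp
          ((F.fusion (Module.finrank ℝ E) (empty_subset Y₁) h₁₂).rTensor
            (GradedDet (Module.finrank ℝ E) (F.cohomology univ Y₂))) =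
        μ • ((F.fusion (Module.finrank ℝ E) (empty_subset Y₁) (subset_univ Y₁)).comp
          (((F.fusion (Module.finrank ℝ E) h₁₂ (subset_univ Y₂)).lTensor
            (GradedDet (Module.finrank ℝ E) (F.cohomology Y₁ ∅))).comp
            (TensorProduct.assoc ℂ (GradedDet (Module.finrank ℝ E) (F.cohomology Y₁ ∅))
              (GradedDet (Module.finrank ℝ E) (F.cohomology Y₂ Y₁))
              (GradedDet (Module.finrank ℝ E) (F.cohomology univ Y₂))).toLinearMap)) :=
  (proposition1p1_general F (empty_subset Y₁) h₁₂ (subset_univ Y₂)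
    (Module.finrank ℝ E)).exists_norm_eq_one_and_eq_smul ℂ
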